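/- **Setting.** Let $E=(E^0,E^1,r,s)$ be a finite directed graph with $E^0\neq\emptyset$. Paths are words $\mu=e_1\cdots e_n$ ($n\ge 0$) with $r(e_{i+1})=s(e_i)$, where $r(\mu)=r(e_1)$, $s(\mu)=s(e_n)$, and the paths of length $0$ are the vertices. Write $E^n$ for the set of paths of length $n$, $E^*=\bigcup_{n\ge0}E^n$, and $vE^n$, $vE^*$ for the paths with range $v$. Let $A_E$ be the adjacency matrix, $A_E(v,w)=|vE^1w|$, where $vE^1w$ is the set of edges with range $v$ and source $w$; let $\rho(\cdot)$ denote the spectral radius. Assume that $E$ is strongly connected: $vE^*w\neq\emptyset$ for all $v,w\in E^0$. Let $\mathcal G$ be a discrete groupoid with unit space $E^0$, and domain and terminus maps $d,t$, with a faithful self-similar action on $E$. That is, each $g\in\mathcal G$ acts as a length-preserving bijection $d(g)E^*\to t(g)E^*$, $\mu\mapsto g\cdot\mu$, with $g\cdot(\mu e)\in (g\cdot\mu)E^1$; this defines an injective groupoid homomorphism that is the identity on units; and for all $g$ and $\mu\in d(g)E^*$ there is a (necessarily unique) $g|_\mu\in\mathcal G$ with $d(g|_\mu)=s(\mu)$ and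 $g\cdot(\mu\nu)=(g\cdot\mu)(g|_\mu\cdot\nu)$ for all $\nu\in s(\mu)E^*$. Let $C^*(\mathcal G)$ be the universal unital C$^*$-algebra generated by elements $u_g$ ($g\in\mathcal G$) with $u_gu_h=\delta_{d(g),t(h)}u_{gh}$, $u_{g^{-1}}=u_g^*$, $\sum_{v\in E^0}u_v=1$. Let $\mathcal T(\mathcal G,E)$ be the universal unital C$^*$-algebra generated by such elements $u_g$ and a Toeplitz–Cuntz–Krieger family $\big((u_v)_{v\in E^0},(s_e)_{e\in E^1}\big)$, i.e. $s_e^*s_e=u_{s(e)}$ and $u_v\ge\sum_{e\in vE^1}s_es_e^*$, subject to $u_gs_e=\delta_{d(g),r(e)}\,s_{g\cdot e}u_{g|_e}$. Write $s_\mu=s_{e_1}\cdots s_{e_n}$ for a path $\mu=e_1\cdots e_n$ with $n\ge1$, and $s_v=u_v$ for a vertex $v$. Let $\mathrm{Tr}(C^*(\mathcal G))$ be the set of tracial states of $C^*(\mathcal G)$. Let $\beta\in\mathbb R$ with $\beta>\log\rho(A_E)$ (where $\log 0=-\infty$). For $\tau\in\mathrm{Tr}(C^*(\mathcal G))$ put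 $$Z(\beta,\tau)=\sum_{k=0}^\infty e^{-\beta k}\sum_{\mu\in E^k}\tau(u_{s(\mu)}),$$ and let $\Psi_{\beta,\tau}$ be the state of $\mathcal T(\mathcal G,E)$ given by $$\Psi_{\beta,\tau}(s_\mu u_gs_\nu^*)=\delta_{\mu,\nu}\,e^{-\beta|\mu|}Z(\beta,\tau)^{-1}\sum_{k=0}^\infty e^{-\beta k}\sum_{\lambda\in s(\mu)E^k,\ g\cdot\lambda=\lambda}\tau(u_{g|_\lambda})$$ for $\mu,\nu\in E^*$ and $g\in\mathcal G$ with $t(g)=s(\mu)$, $d(g)=s(\nu)$. Let $\chi_\beta(\tau)\in\mathrm{Tr}(C^*(\mathcal G))$ be the restriction of $\Psi_{\beta,\tau}$ to $C^*(\mathcal G)$, that is, its composition with the canonical map $C^*(\mathcal G)\to\mathcal T(\mathcal G,E)$, $u_g\mapsto u_g$. **Theorem 2.6.** Under these assumptions, the map $\chi_\beta:\mathrm{Tr}(C^*(\mathcal G))\to\mathrm{Tr}(C^*(\mathcal G))$ is well defined (all the series above converge, $Z(\beta,\tau)\ne0$, and there is exactly one such map); $I-e^{-\beta}A_E$ is invertible;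 and $A_E$ has a unique Perron–Frobenius eigenvector $m=(m_v)_{v\in E^0}$, i.e. $A_Em=\rho(A_E)m$, $m_v>0$ for all $v$, $\sum_vm_v=1$. For every $\tau\in\mathrm{Tr}(C^*(\mathcal G))$ the following hold. 1. The vectors $x^{\chi_\beta^n(\tau)}=\big(\chi_\beta^n(\tau)(u_v)\big)_{v\in E^0}$ converge to $m$ exponentially fast: there are $C>0$ and $0<c<1$ with $|\chi_\beta^n(\tau)(u_v)-m_v|\le C c^n$ for all $n\ge0$ and $v\in E^0$. 2. $Z(\beta,\chi_\beta^n(\tau))$ converges to $\rho\big((I-e^{-\beta}A_E)^{-1}\big)$ exponentially fast: there are $C>0$ and $0<c<1$ with $\big|Z(\beta,\chi_\beta^n(\tau))-\rho\big((I-e^{-\beta}A_E)^{-1}\big)\big|\le C c^n$ for all $n\ge0$. -/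

import Mathlib

open CategoryTheory
open scoped ENNReal ComplexOrder Matrix

universe u

noncomputable section

namespace UniversalCStar

/-- Relations on a set `X` of generators of a unital C⋆-algebra: a class of maps `X → B`, the
*representations*, into unital C⋆-algebras `B`, each of which sends the generators to elements of
norm at most one. -/
structure Relations (X : Type u) where
  /-- The maps that satisfy the relations. -/
  IsRep : ∀ (B : Type u) [CStarAlgebra B], (X → B) → Prop
  norm_le_one : ∀ (B : Type u) [CStarAlgebra B] (f : X → B), IsRep B f → ∀ x, ‖f x‖ ≤ 1

variable {X : Type u} (R : Relations X)

/-- Evaluation of noncommutative `⋆`-polynomials in the generators (`Sum.inl x` stands for `x`, and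
`Sum.inr x` for `x⋆`). -/
def eval {B : Type u} [CStarAlgebra B] (f : X → B) : FreeAlgebra ℂ (X ⊕ X) →ₐ[ℂ] B :=
  FreeAlgebra.lift ℂ (Sum.elim f fun x => star (f x))

/-- The functions `p ↦ ‖p(f)‖` on `⋆`-polynomials, for `f` a representation in a nonzero
C⋆-algebra. There is a *set* of those, whereas there is a proper class of representations. -/
def Index : Type u :=
  {N : FreeAlgebra ℂ (X ⊕ X) → ℝ // ∃ (B : Type u) (_ : CStarAlgebra B) (f : X → B),
    Nontrivial B ∧ R.IsRep B f ∧ ∀ p, N p = ‖eval f p‖}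

variable {R}

/-- The target of a representation with the given norm function. -/
def Index.Alg (i : Index R) : Type u := i.2.choose

instance (i : Index R) : CStarAlgebra i.Alg := i.2.choose_spec.choose

/-- A representation with the given norm function. -/
def Index.rep (i : Index R) : X → i.Alg := i.2.choose_spec.choose_spec.choose

instance (i : Index R) : Nontrivial i.Alg := i.2.choose_spec.choose_spec.choose_spec.1

theorem Index.isRep (i : Index R) : R.IsRep i.Alg i.rep :=
  i.2.choose_spec.choose_spec.choose_spec.2.1

theorem Index.norm_eval (i : Index R) (p : FreeAlgebra ℂ (X ⊕ X)) :
    i.1 p = ‖eval i.rep p‖ :=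
  i.2.choose_spec.choose_spec.choose_spec.2.2 p

variable (R)

/-- The `ℓ^∞`-product of the targets of the representations. -/
abbrev Product : Type u := lp (fun i : Index R => i.Alg) ∞

instance : CStarAlgebra (Product R) where

/-- The family of all representations. -/
def productGen (x : X) : Product R :=
  ⟨fun i => i.rep x, memℓp_infty ⟨1, by
    rintro _ ⟨i, rfl⟩
    exact R.norm_le_one _ _ i.isRep x⟩⟩

/-- The closed unital `⋆`-subalgebra of the product that is generated by the family of all
representations. -/
def subalg : StarSubalgebra ℂ (Product R) :=
  (StarAlgebra.adjoin ℂ (Set.range (productGen R))).topologicalClosure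

instance : IsClosed (subalg R : Set (Product R)) :=
  StarSubalgebra.isClosed_topologicalClosure _

end UniversalCStar

/-- The universal unital C⋆-algebra with the given generators and relations: the closed
`⋆`-algebra generated by the generators in the product of all representations.
See `UniversalCStar.existsUnique_lift` for its universal property. -/
def UniversalCStar {X : Type u} (R : UniversalCStar.Relations X) : Type u := UniversalCStar.subalg R

instance {X : Type u} (R : UniversalCStar.Relations X) : CStarAlgebra (UniversalCStar R) :=
  inferInstanceAs (CStarAlgebra (UniversalCStar.subalg R))

namespace UniversalCStar

variable {X : Type u} {R : Relations X}

/-- The generators. -/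
def gen (x : X) : UniversalCStar R :=
  (⟨productGen R x, StarSubalgebra.le_topologicalClosure _
    (StarAlgebra.subset_adjoin ℂ _ ⟨x, rfl⟩)⟩ : subalg R)

/-- The coordinate projections. -/
def coord (i : Index R) : UniversalCStar R →⋆ₐ[ℂ] i.Alg where
  toFun a := (a : subalg R).1 i
  map_one' := rfl
  map_mul' _ _ := rfl
  map_zero' := rfl
  map_add' _ _ := rfl
  commutes' _ := rfl
  map_star' _ := rfl

theorem coord_gen (i : Index R) (x : X) : coord i (gen x) = i.rep x := rfl

theorem ext_coord {a b : UniversalCStar R} (h : ∀ i : Index R, coord i a = coord i b) : a = b :=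
  Subtype.ext (lp.ext (funext h))

theorem norm_coord_le (i : Index R) (a : UniversalCStar R) : ‖coord i a‖ ≤ ‖a‖ :=
  lp.norm_apply_le_norm ENNReal.top_ne_zero (a : subalg R).1 i


theorem map_eval {B C : Type u} [CStarAlgebra B] [CStarAlgebra C] (φ : B →⋆ₐ[ℂ] C) (f : X → B)
    (p : FreeAlgebra ℂ (X ⊕ X)) : φ (eval f p) = eval (fun x => φ (f x)) p := by
  have : (φ : B →ₐ[ℂ] C).comp (eval f) = eval (fun x => φ (f x)) := by
    refine FreeAlgebra.hom_ext (funext fun x => ?_)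
    rcases x with x | x <;> simp [eval, map_star]
  exact DFunLike.congr_fun this p

theorem exists_eval_of_mem_adjoin {B : Type u} [CStarAlgebra B] (f : X → B) {b : B}
    (hb : b ∈ StarAlgebra.adjoin ℂ (Set.range f)) : ∃ p, eval f p = b := by
  induction hb using StarAlgebra.adjoin_induction with
  | mem x hx =>
    obtain ⟨x, rfl⟩ := hx
    exact ⟨FreeAlgebra.ι ℂ (Sum.inl x), by simp [eval]⟩
  | algebraMap r => exact ⟨algebraMap ℂ _ r, by simp⟩
  | add x y _ _ hx hy =>
    obtain ⟨p, rfl⟩ := hx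
    obtain ⟨q, rfl⟩ := hy
    exact ⟨p + q, by simp⟩
  | mul x y _ _ hx hy =>
    obtain ⟨p, rfl⟩ := hx
    obtain ⟨q, rfl⟩ := hy
    exact ⟨p * q, by simp⟩
  | star x hx' hx =>
    obtain ⟨p, rfl⟩ := hx
    clear hx'
    induction p using FreeAlgebra.induction with
    | grade0 r => exact ⟨algebraMap ℂ _ (star r), (by simpa using (algebraMap_star_comm r : _))⟩
    | grade1 x =>
      rcases x with x | x
      · exact ⟨FreeAlgebra.ι ℂ (Sum.inr x), by simp [eval]⟩
      · exact ⟨FreeAlgebra.ι ℂ (Sum.inl x), by simp [eval]⟩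
    | mul a b ha hb =>
      obtain ⟨p, hp⟩ := ha
      obtain ⟨q, hq⟩ := hb
      exact ⟨q * p, by simp [hp, hq]⟩
    | add a b ha hb =>
      obtain ⟨p, hp⟩ := ha
      obtain ⟨q, hq⟩ := hb
      exact ⟨p + q, by simp [hp, hq]⟩

theorem norm_eval_le {B : Type u} [CStarAlgebra B] {f : X → B} (hf : R.IsRep B f)
    (p : FreeAlgebra ℂ (X ⊕ X)) : ‖eval f p‖ ≤ ‖eval (gen : X → UniversalCStar R) p‖ := by
  rcases subsingleton_or_nontrivial B with hB | hB
  · rw [Subsingleton.elim (eval f p) 0, norm_zero]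
    exact norm_nonneg _
  · let i : Index R := ⟨fun p => ‖eval f p‖, B, _, f, hB, hf, fun _ => rfl⟩
    have h1 : ‖eval f p‖ = ‖eval i.rep p‖ := i.norm_eval p
    have h2 : eval i.rep p = coord i (eval gen p) := (map_eval (coord i) gen p).symm
    rw [h1, h2]
    exact norm_coord_le i _

theorem dense_adjoin_gen :
    Dense (StarAlgebra.adjoin ℂ (Set.range (gen : X → UniversalCStar R)) :
      Set (UniversalCStar R)) := by
  let ι : UniversalCStar R →⋆ₐ[ℂ] Product R := (subalg R).subtype
  have hι : Topology.IsInducing ι := Topology.IsInducing.subtypeVal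
  have hmap : (StarAlgebra.adjoin ℂ (Set.range (gen : X → UniversalCStar R))).map ι =
      StarAlgebra.adjoin ℂ (Set.range (productGen R)) := by
    rw [StarAlgHom.map_adjoin, ← Set.range_comp]
    rfl
  intro a
  rw [hι.closure_eq_preimage_closure_image]
  have h2 := congrArg (fun S : StarSubalgebra ℂ (Product R) => (S : Set (Product R))) hmap
  have h3 : (a : subalg R).1 ∈ (StarAlgebra.adjoin ℂ (Set.range (productGen R))).topologicalClosure :=
    (a : subalg R).2
  rw [← SetLike.mem_coe, StarSubalgebra.topologicalClosure_coe] at h3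
  simp only [StarSubalgebra.coe_map] at h2
  rw [Set.mem_preimage, h2]
  exact h3

theorem hom_ext {B : Type u} [CStarAlgebra B] {φ ψ : UniversalCStar R →⋆ₐ[ℂ] B}
    (h : ∀ x, φ (gen x) = ψ (gen x)) : φ = ψ := by
  have hφ : Continuous φ := AddMonoidHomClass.continuous_of_bound φ 1 fun a => by
    simpa using NonUnitalStarAlgHom.norm_apply_le φ a
  have hψ : Continuous ψ := AddMonoidHomClass.continuous_of_bound ψ 1 fun a => by
    simpa using NonUnitalStarAlgHom.norm_apply_le ψ a
  refine DFunLike.coe_injective (Continuous.ext_on dense_adjoin_gen hφ hψ fun a ha => ?_)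
  obtain ⟨p, rfl⟩ := exists_eval_of_mem_adjoin _ ha
  rw [map_eval, map_eval]
  simp only [h]

/-- The universal property. -/
theorem existsUnique_lift {B : Type u} [CStarAlgebra B] (f : X → B) (hf : R.IsRep B f) :
    ∃! φ : UniversalCStar R →⋆ₐ[ℂ] B, ∀ x, φ (gen x) = f x := by
  refine existsUnique_of_exists_of_unique ?_
    fun φ ψ h1 h2 => hom_ext fun x => (h1 x).trans (h2 x).symm
  let A := UniversalCStar R
  let _ : CStarAlgebra (A × B) := {}
  let g : X → A × B := fun x => (gen x, f x)
  let D : StarSubalgebra ℂ (A × B) := (StarAlgebra.adjoin ℂ (Set.range g)).topologicalClosure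
  have hclosed : IsClosed (D : Set (A × B)) := StarSubalgebra.isClosed_topologicalClosure _
  let F : (A × B) →⋆ₐ[ℂ] A := StarAlgHom.fst ℂ A B
  let S : (A × B) →⋆ₐ[ℂ] B := StarAlgHom.snd ℂ A B
  have hD : ∀ d ∈ D, ‖S d‖ ≤ ‖F d‖ := by
    have hc : IsClosed {d : A × B | ‖S d‖ ≤ ‖F d‖} :=
      isClosed_le (continuous_snd.norm) (continuous_fst.norm)
    have : closure (StarAlgebra.adjoin ℂ (Set.range g) : Set (A × B)) ⊆
        {d : A × B | ‖S d‖ ≤ ‖F d‖} := by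
      refine closure_minimal (fun d hd => ?_) hc
      obtain ⟨p, rfl⟩ := exists_eval_of_mem_adjoin _ hd
      rw [Set.mem_ofPred_eq, map_eval, map_eval]
      exact norm_eval_le hf p
    intro d hd
    refine this ?_
    rw [← StarSubalgebra.topologicalClosure_coe]
    exact hd
  let F' : D →⋆ₐ[ℂ] A := F.comp D.subtype
  have hiso : Isometry F' := AddMonoidHomClass.isometry_of_norm F' fun d =>
    (max_eq_left (hD d.1 d.2)).symm
  have : CompleteSpace D := hclosed.completeSpace_coe
  have hsurj : Function.Surjective F' := by
    have hr : IsClosed (Set.range F') := hiso.isClosedEmbedding.isClosed_range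
    intro a
    have h1 : (StarAlgebra.adjoin ℂ (Set.range (gen : X → A)) : Set A) ⊆ Set.range F' := by
      have h2 : StarAlgebra.adjoin ℂ (Set.range (gen : X → A)) ≤ F'.range := by
        refine StarAlgebra.adjoin_le ?_
        rintro _ ⟨x, rfl⟩
        exact ⟨⟨g x, StarSubalgebra.le_topologicalClosure _
          (StarAlgebra.subset_adjoin ℂ _ ⟨x, rfl⟩)⟩, rfl⟩
      exact h2
    exact closure_minimal h1 hr (dense_adjoin_gen a)
  let e : D ≃⋆ₐ[ℂ] A := StarAlgEquiv.ofBijective F' ⟨hiso.injective, hsurj⟩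
  refine ⟨(S.comp D.subtype).comp (e.symm : A →⋆ₐ[ℂ] D), fun x => ?_⟩
  have hx : e.symm (gen x) = ⟨g x, StarSubalgebra.le_topologicalClosure _
      (StarAlgebra.subset_adjoin ℂ _ ⟨x, rfl⟩)⟩ := by
    rw [StarAlgEquiv.symm_apply_eq]
    rfl
  change S (e.symm (gen x)).1 = f x
  rw [hx]
  rfl

/-- The homomorphism given by a representation. -/
def lift {B : Type u} [CStarAlgebra B] (f : X → B) (hf : R.IsRep B f) :
    UniversalCStar R →⋆ₐ[ℂ] B :=
  (existsUnique_lift f hf).choose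

theorem lift_gen {B : Type u} [CStarAlgebra B] (f : X → B) (hf : R.IsRep B f) (x : X) :
    lift f hf (gen x) = f x :=
  (existsUnique_lift f hf).choose_spec.1 x

end UniversalCStar

/-! ### States and traces -/

/-- States of a unital C⋆-algebra: positive linear functionals that take the value one at `1`. -/
structure CStarState (A : Type u) [CStarAlgebra A] where
  toLinearMap : A →ₗ[ℂ] ℂ
  nonneg : ∀ a : A, 0 ≤ toLinearMap (star a * a)
  map_one : toLinearMap 1 = 1

instance {A : Type u} [CStarAlgebra A] : CoeFun (CStarState A) fun _ => A → ℂ :=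
  ⟨fun φ => φ.toLinearMap⟩

/-- Normalised traces, that is, tracial states, of a unital C⋆-algebra. -/
structure CStarTrace (A : Type u) [CStarAlgebra A] extends CStarState A where
  map_mul_comm : ∀ a b : A, toLinearMap (a * b) = toLinearMap (b * a)

instance {A : Type u} [CStarAlgebra A] : CoeFun (CStarTrace A) fun _ => A → ℂ :=
  ⟨fun φ => φ.toLinearMap⟩

/-! ### Groupoids and their C⋆-algebras

A groupoid with unit space `V` is a Mathlib groupoid with `V` as type of objects; `g : x ⟶ y` is an
element with domain `d(g) = x` and terminus `t(g) = y`. The product `gh` is defined when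
`d(g) = t(h)`, and is `h ≫ g` in Mathlib's notation. -/

/-- The set of all elements of a groupoid. -/
abbrev GroupoidElt (V : Type u) [Groupoid.{u} V] : Type u := Σ x y : V, (x ⟶ y)

/-- A morphism as an element of the groupoid. -/
abbrev elt {V : Type u} [Groupoid.{u} V] {x y : V} (g : x ⟶ y) : GroupoidElt V := ⟨x, y, g⟩

/-- Unital representations of a discrete groupoid with finite unit space in a C⋆-algebra:
`v_g v_h = δ_{d(g),t(h)} v_{gh}`, `v_{g⁻¹} = v_g⋆` and `∑_x v_x = 1`. It follows that the `v_g` are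
partial isometries. -/
structure IsGroupoidRep {V : Type u} [Groupoid.{u} V] [Fintype V] {B : Type u} [CStarAlgebra B]
    (v : GroupoidElt V → B) : Prop where
  mul {x y z : V} (g : y ⟶ z) (h : x ⟶ y) : v (elt g) * v (elt h) = v (elt (h ≫ g))
  mul_of_ne {x y y' z : V} (g : y' ⟶ z) (h : x ⟶ y) (hne : y' ≠ y) : v (elt g) * v (elt h) = 0
  inv {x y : V} (g : x ⟶ y) : v (elt (Groupoid.inv g)) = star (v (elt g))
  sum_unit : ∑ x : V, v (elt (𝟙 x)) = 1

theorem norm_le_one_of_star_mul_self {B : Type u} [CStarAlgebra B] {b p : B} (hb : star b * b = p)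
    (hp : p * p = p) : ‖b‖ ≤ 1 := by
  have hs : star p = p := by rw [← hb, star_mul, star_star]
  have h1 : ‖p‖ * ‖p‖ = ‖p‖ := by rw [← CStarRing.norm_star_mul_self (x := p), hs, hp]
  have h2 : ‖b‖ * ‖b‖ = ‖p‖ := by rw [← CStarRing.norm_star_mul_self (x := b), hb]
  nlinarith [norm_nonneg b, norm_nonneg p, sq_nonneg (‖p‖ - 1)]

theorem IsGroupoidRep.norm_le_one {V : Type u} [Groupoid.{u} V] [Fintype V] {B : Type u}
    [CStarAlgebra B] {v : GroupoidElt V → B} (hv : IsGroupoidRep v) (g : GroupoidElt V) :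
    ‖v g‖ ≤ 1 := by
  obtain ⟨x, y, g⟩ := g
  refine norm_le_one_of_star_mul_self (p := v (elt (𝟙 x))) ?_ ?_
  · rw [← hv.inv, hv.mul]
    simp
  · rw [hv.mul]
    simp

/-- The relations that define the C⋆-algebra of a groupoid. -/
def groupoidRelations (V : Type u) [Groupoid.{u} V] [Fintype V] :
    UniversalCStar.Relations (GroupoidElt V) where
  IsRep _ _ v := IsGroupoidRep v
  norm_le_one _ _ _ hv := hv.norm_le_one

/-- The (full) C⋆-algebra `C⋆(𝒢)` of a discrete groupoid with finite unit space. -/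
abbrev GroupoidCStar (V : Type u) [Groupoid.{u} V] [Fintype V] : Type u :=
  UniversalCStar (groupoidRelations V)

/-- The canonical generators `u_g` of `C⋆(𝒢)`. -/
def GroupoidCStar.u {V : Type u} [Groupoid.{u} V] [Fintype V] {x y : V} (g : x ⟶ y) :
    GroupoidCStar V :=
  UniversalCStar.gen (elt g)

theorem GroupoidCStar.isGroupoidRep (V : Type u) [Groupoid.{u} V] [Fintype V] :
    IsGroupoidRep (UniversalCStar.gen : GroupoidElt V → GroupoidCStar V) where
  mul g h := UniversalCStar.ext_coord fun i => by
    rw [map_mul]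
    exact i.isRep.mul g h
  mul_of_ne g h hne := UniversalCStar.ext_coord fun i => by
    rw [map_mul, map_zero]
    exact i.isRep.mul_of_ne g h hne
  inv g := UniversalCStar.ext_coord fun i => by
    rw [map_star]
    exact i.isRep.inv g
  sum_unit := UniversalCStar.ext_coord fun i => by
    rw [map_sum, map_one]
    exact i.isRep.sum_unit

/-! ### Directed graphs and their paths -/

/-- A directed graph `E` with vertex set `V = E⁰`, edge set `D = E¹`, range map `r` and source
map `s`. -/
structure DirGraph (V D : Type u) where
  r : D → V
  s : D → V

namespace DirGraph

variable {V D : Type u} (E : DirGraph V D)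

/-- `e₁e₂…eₙ` is a path with range `v`: `r(e₁) = v` and `r(eᵢ₊₁) = s(eᵢ)`. The empty list stands for
the path `v` of length zero. -/
def IsPathFrom : V → List D → Prop
  | _, [] => True
  | v, e :: l => E.r e = v ∧ IsPathFrom (E.s e) l

/-- The source of the path with range `v` and the given list of edges. -/
def listSource : V → List D → V
  | v, [] => v
  | _, e :: l => listSource (E.s e) l

/-- The set `vE⋆` of paths with range `v`, of any length `≥ 0`. -/
abbrev Path (v : V) : Type u := {l : List D // E.IsPathFrom v l}

theorem isPathFrom_append {v : V} {l m : List D} (hl : E.IsPathFrom v l)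
    (hm : E.IsPathFrom (E.listSource v l) m) : E.IsPathFrom v (l ++ m) := by
  induction l generalizing v with
  | nil => exact hm
  | cons e l ih => exact ⟨hl.1, ih hl.2 hm⟩

variable {E} {v w : V}

/-- The edges of a path. -/
def Path.edges (μ : E.Path v) : List D := μ.1

/-- The length `|μ|`. -/
def Path.length (μ : E.Path v) : ℕ := μ.edges.length

/-- The source `s(μ)`. -/
def Path.source (μ : E.Path v) : V := E.listSource v μ.edges

/-- The path `μν`, for `r(ν) = s(μ)`. -/
def Path.append (μ : E.Path v) (ν : E.Path μ.source) : E.Path v :=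
  ⟨μ.edges ++ ν.edges, E.isPathFrom_append μ.2 ν.2⟩

/-- An edge `e` with `r(e) = v` as a path of length one. -/
def edgePath (e : D) (he : E.r e = v) : E.Path v := ⟨[e], he, trivial⟩

variable (E)

theorem finite_paths [Finite D] (v : V) (k : ℕ) : {μ : E.Path v | μ.length = k}.Finite :=
  Set.Finite.preimage Subtype.val_injective.injOn (List.finite_length_eq D k)

/-- The finite set `vEᵏ` of paths with range `v` and length `k`. -/
def paths [Finite D] (v : V) (k : ℕ) : Finset (E.Path v) := (E.finite_paths v k).toFinset

/-- `E` is strongly connected: `vE⋆w` is nonempty for all vertices `v` and `w`. -/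
def StronglyConnected : Prop := ∀ v w : V, ∃ μ : E.Path v, μ.source = w

/-- The adjacency matrix `A_E(v, w) = |vE¹w|`. -/
def adj : Matrix V V ℝ := fun v w => Nat.card {e : D // E.r e = v ∧ E.s e = w}

/-- Partial isomorphisms `vE⋆ → wE⋆` of the forest of paths: length-preserving bijections `g` with
`g(μe) ∈ g(μ)E¹`. -/
@[ext]
structure PartialIso (v w : V) where
  toEquiv : E.Path v ≃ E.Path w
  length_map : ∀ μ, (toEquiv μ).length = μ.length
  map_append_edge : ∀ (μ : E.Path v) (e : D) (he : E.r e = μ.source),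
    ∃ (f : D) (hf : E.r f = (toEquiv μ).source),
      toEquiv (μ.append (edgePath e he)) = (toEquiv μ).append (edgePath f hf)

end DirGraph

/-! ### Self-similar actions -/

/-- A faithful self-similar action of a groupoid `𝒢` with unit space `V = E⁰` on the graph `E`: a
homomorphism `g ↦ (μ ↦ g · μ)` of groupoids, injective and the identity on unit spaces, from `𝒢` to
the groupoid of partial isomorphisms, such that for `g ∈ 𝒢` and `μ ∈ d(g)E⋆` there is `k ∈ 𝒢` with
`d(k) = s(μ)` and `g · (μν) = (g · μ)(k · ν)` for all `ν ∈ s(μ)E⋆`. -/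
structure SelfSimilarAction {V D : Type u} [Groupoid.{u} V] (E : DirGraph V D) where
  act {x y : V} (g : x ⟶ y) : E.PartialIso x y
  act_id (x : V) (μ : E.Path x) : (act (𝟙 x)).toEquiv μ = μ
  act_comp {x y z : V} (h : x ⟶ y) (g : y ⟶ z) (μ : E.Path x) :
    (act (h ≫ g)).toEquiv μ = (act g).toEquiv ((act h).toEquiv μ)
  faithful (x y : V) : Function.Injective (act : (x ⟶ y) → E.PartialIso x y)
  exists_restrict {x y : V} (g : x ⟶ y) (μ : E.Path x) :
    ∃ k : μ.source ⟶ ((act g).toEquiv μ).source, ∀ ν : E.Path μ.source,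
      (act g).toEquiv (μ.append ν) = ((act g).toEquiv μ).append ((act k).toEquiv ν)

namespace SelfSimilarAction

variable {V D : Type u} [Groupoid.{u} V] {E : DirGraph V D} (S : SelfSimilarAction E)

/-- `g · μ`. -/
def app {x y : V} (g : x ⟶ y) (μ : E.Path x) : E.Path y := (S.act g).toEquiv μ

/-- The restriction `g|_μ`. By faithfulness it is the only element as in the definition of a
self-similar action. -/
def restrict {x y : V} (g : x ⟶ y) (μ : E.Path x) : μ.source ⟶ (S.app g μ).source :=
  (S.exists_restrict g μ).choose

theorem app_append {x y : V} (g : x ⟶ y) (μ : E.Path x) (ν : E.Path μ.source) :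
    S.app g (μ.append ν) = (S.app g μ).append (S.app (S.restrict g μ) ν) :=
  (S.exists_restrict g μ).choose_spec ν

open Classical in
/-- The finite set of those `μ ∈ d(g)Eᵏ` with `g · μ = μ`. -/
def fixedPaths [Finite D] {x : V} (g : x ⟶ x) (k : ℕ) : Finset (E.Path x) :=
  (E.paths x k).filter fun μ => S.app g μ = μ

end SelfSimilarAction

/-! ### The Toeplitz algebra of a self-similar action -/

section Toeplitz

variable {V D : Type u} [Groupoid.{u} V] [Fintype V] {E : DirGraph V D} (S : SelfSimilarAction E)

/-- `t_μ = t_{e₁}⋯t_{eₙ}` for a path `μ = e₁…eₙ`, and `t_v = q_v = v_{id_v}` for `v ∈ E⁰`. -/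
def pathElt {B : Type u} [CStarAlgebra B] (v : GroupoidElt V → B) (t : D → B) {x : V}
    (μ : E.Path x) : B :=
  v (elt (𝟙 x)) * (μ.edges.map t).prod

/-- Toeplitz representations of a self-similar action. With `q_w = v_{id_w}`, the fields say
* `v` is a unital representation of the groupoid, so that the `q_w` are mutually orthogonal
  projections with sum one, and `v_g q_w = δ_{d(g),w} q_{g·w} v_g`;
* `(q, t)` is a Toeplitz–Cuntz–Krieger family: `t_e⋆ t_e = q_{s(e)}`, and the `t_e t_e⋆` with
  `r(e) = w` are mutually orthogonal projections below `q_w`, that is, `q_w ≥ ∑_{e ∈ wE¹} t_e t_e⋆`;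
* `v_g t_e = δ_{d(g),r(e)} t_{g·e} v_{g|_e}`. -/
structure IsToeplitzRep {B : Type u} [CStarAlgebra B] (v : GroupoidElt V → B) (t : D → B) : Prop
    extends IsGroupoidRep v where
  star_mul_self (e : D) : star (t e) * t e = v (elt (𝟙 (E.s e)))
  star_mul_of_ne {e f : D} (hne : e ≠ f) : star (t e) * t f = 0
  range_mul (e : D) : v (elt (𝟙 (E.r e))) * t e = t e
  covariance {x y : V} (g : x ⟶ y) (e : D) (he : E.r e = x) :
    v (elt g) * t e =
      pathElt v t (S.app g (DirGraph.edgePath e he)) *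
        v (elt (S.restrict g (DirGraph.edgePath e he)))
  mul_of_range_ne {x y : V} (g : x ⟶ y) (e : D) (he : E.r e ≠ x) : v (elt g) * t e = 0

/-- The relations that define the Toeplitz algebra. -/
def toeplitzRelations : UniversalCStar.Relations (GroupoidElt V ⊕ D) where
  IsRep _ _ f := IsToeplitzRep S (f ∘ Sum.inl) (f ∘ Sum.inr)
  norm_le_one _ _ f hf x := by
    rcases x with g | e
    · exact hf.toIsGroupoidRep.norm_le_one g
    · refine norm_le_one_of_star_mul_self (hf.star_mul_self e) ?_
      rw [hf.mul]
      simp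

/-- The Toeplitz algebra `𝒯(𝒢, E)`. -/
abbrev ToeplitzCStar : Type u := UniversalCStar (toeplitzRelations S)

namespace ToeplitzCStar

/-- The canonical elements `u_g` of `𝒯(𝒢, E)`. -/
def u {x y : V} (g : x ⟶ y) : ToeplitzCStar S := UniversalCStar.gen (Sum.inl (elt g))

/-- The canonical elements `s_μ` of `𝒯(𝒢, E)`. -/
def s {x : V} (μ : E.Path x) : ToeplitzCStar S :=
  pathElt (fun g => UniversalCStar.gen (Sum.inl g)) (fun e => UniversalCStar.gen (Sum.inr e)) μ

theorem isToeplitzRep :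
    IsToeplitzRep S (fun g => (UniversalCStar.gen (Sum.inl g) : ToeplitzCStar S))
      (fun e => UniversalCStar.gen (Sum.inr e)) where
  mul g h := UniversalCStar.ext_coord fun i => by
    rw [map_mul]
    exact i.isRep.mul g h
  mul_of_ne g h hne := UniversalCStar.ext_coord fun i => by
    rw [map_mul, map_zero]
    exact i.isRep.mul_of_ne g h hne
  inv g := UniversalCStar.ext_coord fun i => by
    rw [map_star]
    exact i.isRep.inv g
  sum_unit := UniversalCStar.ext_coord fun i => by
    rw [map_sum, map_one]
    exact i.isRep.sum_unit
  star_mul_self e := UniversalCStar.ext_coord fun i => by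
    rw [map_mul, map_star]
    exact i.isRep.star_mul_self e
  star_mul_of_ne hne := UniversalCStar.ext_coord fun i => by
    rw [map_mul, map_star, map_zero]
    exact i.isRep.star_mul_of_ne hne
  range_mul e := UniversalCStar.ext_coord fun i => by
    rw [map_mul]
    exact i.isRep.range_mul e
  covariance g e he := UniversalCStar.ext_coord fun i => by
    rw [map_mul, map_mul, pathElt, map_mul, map_list_prod, List.map_map]
    exact i.isRep.covariance g e he
  mul_of_range_ne g e he := UniversalCStar.ext_coord fun i => by
    rw [map_mul, map_zero]
    exact i.isRep.mul_of_range_ne g e he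

end ToeplitzCStar

/-- The canonical homomorphism `C⋆(𝒢) → 𝒯(𝒢, E)`, `u_g ↦ u_g`. -/
def toToeplitz : GroupoidCStar V →⋆ₐ[ℂ] ToeplitzCStar S :=
  UniversalCStar.lift (fun g => UniversalCStar.gen (Sum.inl g))
    (ToeplitzCStar.isToeplitzRep S).toIsGroupoidRep

theorem toToeplitz_u {x y : V} (g : x ⟶ y) :
    toToeplitz S (GroupoidCStar.u g) = ToeplitzCStar.u S g :=
  UniversalCStar.lift_gen _ _ _

end Toeplitz

/-! ### The self-map of the trace simplex -/

section Chi

variable {V D : Type u} [Groupoid.{u} V] [Fintype V] [Finite D] {E : DirGraph V D}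

/-- The `k`-th term `e^{-βk} ∑_{μ ∈ Eᵏ} τ(u_{s(μ)})` of the partition function. -/
def partitionTerm (E : DirGraph V D) (β : ℝ) (τ : CStarTrace (GroupoidCStar V)) (k : ℕ) : ℂ :=
  (Real.exp (-β * k) : ℂ) * ∑ v : V, ∑ μ ∈ E.paths v k, τ (GroupoidCStar.u (𝟙 μ.source))

/-- The partition function `Z(β, τ)`. -/
def partitionFn (E : DirGraph V D) (β : ℝ) (τ : CStarTrace (GroupoidCStar V)) : ℂ :=
  ∑' k, partitionTerm E β τ k

/-- The `k`-th term `e^{-βk} ∑_{λ ∈ xEᵏ, g·λ = λ} τ(u_{g|_λ})`, for `d(g) = t(g) = x`. -/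
def psiTerm (S : SelfSimilarAction E) (β : ℝ) (τ : CStarTrace (GroupoidCStar V)) {x : V}
    (g : x ⟶ x) (k : ℕ) : ℂ :=
  (Real.exp (-β * k) : ℂ) * ∑ l ∈ S.fixedPaths g k, τ (GroupoidCStar.u (S.restrict g l))

/-- `Ψ` is the state `Ψ_{β,τ}` of `𝒯(𝒢, E)`: the series that define it converge, `Z(β, τ) ≠ 0`, and
`Ψ(s_μ u_g s_ν⋆) = δ_{μ,ν} e^{-β|μ|} Z(β,τ)⁻¹ ∑_k e^{-βk} ∑_{λ ∈ s(μ)Eᵏ, g·λ = λ} τ(u_{g|_λ})`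
for all `μ, ν ∈ E⋆` and all `g ∈ 𝒢` with `t(g) = s(μ)` and `d(g) = s(ν)`. -/
structure IsPsi (S : SelfSimilarAction E) (β : ℝ) (τ : CStarTrace (GroupoidCStar V))
    (Ψ : CStarState (ToeplitzCStar S)) : Prop where
  summable_partitionTerm : Summable (partitionTerm E β τ)
  partitionFn_ne_zero : partitionFn E β τ ≠ 0
  summable_psiTerm {x : V} (g : x ⟶ x) : Summable (psiTerm S β τ g)
  apply_self {x : V} (μ : E.Path x) (g : μ.source ⟶ μ.source) :
    Ψ (ToeplitzCStar.s S μ * ToeplitzCStar.u S g * star (ToeplitzCStar.s S μ)) =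
      (Real.exp (-β * μ.length) : ℂ) * (partitionFn E β τ)⁻¹ * ∑' k, psiTerm S β τ g k
  apply_of_ne {x y : V} (μ : E.Path x) (ν : E.Path y) (g : ν.source ⟶ μ.source)
    (hne : (⟨x, μ⟩ : Σ v, E.Path v) ≠ ⟨y, ν⟩) :
    Ψ (ToeplitzCStar.s S μ * ToeplitzCStar.u S g * star (ToeplitzCStar.s S ν)) = 0

/-- `χ` is the map `χ_β : τ ↦ Ψ_{β,τ}|_{C⋆(𝒢)}` from the traces of `C⋆(𝒢)` to themselves. -/
def IsChi (S : SelfSimilarAction E) (β : ℝ)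
    (χ : CStarTrace (GroupoidCStar V) → CStarTrace (GroupoidCStar V)) : Prop :=
  ∀ τ, ∃ Ψ : CStarState (ToeplitzCStar S), IsPsi S β τ Ψ ∧ ∀ a, χ τ a = Ψ (toToeplitz S a)

end Chi

/-! ### Perron–Frobenius theory -/

section Matrices

variable {V : Type u} [Fintype V] [DecidableEq V]

/-- The spectral radius of a real matrix: the largest modulus of a complex eigenvalue. -/
def matrixSpectralRadius (A : Matrix V V ℝ) : ℝ≥0∞ :=
  spectralRadius ℂ (A.map (fun a : ℝ => (a : ℂ)))

/-- `m` is the Perron–Frobenius eigenvector of `A`: the positive eigenvector for the eigenvalue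
`ρ(A)` whose entries sum to one. -/
structure IsPerronFrobenius (A : Matrix V V ℝ) (m : V → ℝ) : Prop where
  pos : ∀ v, 0 < m v
  sum_eq_one : ∑ v, m v = 1
  mulVec_eq : A *ᵥ m = (matrixSpectralRadius A).toReal • m

/-- The matrix `(I - e^{-β} A)⁻¹`. -/
def resolventMatrix (A : Matrix V V ℝ) (β : ℝ) : Matrix V V ℝ := (1 - Real.exp (-β) • A)⁻¹

end Matrices

end

/-!
The matrix `R = (I - e^{-β} A_E)⁻¹` governs everything. Counting paths gives
`Z(β, τ) = ∑_v (R x^τ)_v`, and evaluating `Ψ_{β,τ}` at the projections `u_v` shows that `χ_β` acts on the vectors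
`x^τ` as `x ↦ R x / ‖R x‖₁` (`IsPsi.weight_restrict`). Since `E` is strongly connected, `R` is
entrywise positive, so this is the power method, and it converges exponentially to the positive
eigenvector of `R` (`normalized_iterate_tendsto_exp`): one application of `R` shrinks the interval
of the ratios `y_v / m_v` by a fixed factor (`exists_contraction`). The eigenvector is the
Perron–Frobenius eigenvector `m` of `A_E`. Along the iteration `Z` converges to `∑_v (R m)_v`, which
is the eigenvalue of `R` at `m`, and a nonnegative matrix with a positive eigenvector has the
corresponding eigenvalue as its spectral radius (`matrixSpectralRadius_eq_of_pos_eigenvector`). The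
Perron–Frobenius theorem itself is proved by maximising the Collatz–Wielandt number
(`exists_pos_eigenvector`, `pos_eigenvector_unique`), and it also yields
`A_E^k(v, w) ≤ ρ^k m_v / m_w`, whence the Neumann series of `R` converges.

The existence of the state `Ψ_{β,τ}` needs a representation of the Toeplitz algebra. The GNS
representation of `τ` restricts to a unitary representation `x ↦ H_x` of the groupoid with vectors
`η_x ∈ H_x` such that `τ(u_g) = ⟨η_x, W(g) η_x⟩` (`GroupoidHilbertRep.exists_of_trace`). On the
Hilbert sum of the spaces `H_{s(μ)}` over all paths `μ`, the groupoid acts by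
`δ_μ ⊗ a ↦ δ_{g·μ} ⊗ W(g|_μ) a` and the edges act as creation operators (`GroupoidHilbertRep.isToeplitzRep`). The
weighted sum of the vector states at `δ_μ ⊗ η_{s(μ)}`, with weights `e^{-β|μ|} / Z(β, τ)`, is the
required state (`GroupoidHilbertRep.exists_isPsi`). Its restriction to `C⋆(𝒢)` is a trace because
`μ ↦ h · μ` maps the paths fixed by `gh` onto those fixed by `hg` (`psiTerm_comp_comm`), and it is
unique because the span of the `u_g` is dense.
-/

/-! ### Nonnegative matrices -/

section NonnegMatrix

variable {V : Type u} [Fintype V]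

theorem Matrix.mulVec_nonneg_of_nonneg {B : Matrix V V ℝ} (hB : ∀ v w, 0 ≤ B v w) {y : V → ℝ}
    (hy : ∀ v, 0 ≤ y v) (v : V) : 0 ≤ (B *ᵥ y) v :=
  Finset.sum_nonneg fun w _ => mul_nonneg (hB v w) (hy w)

theorem Matrix.mulVec_pos_of_pos {B : Matrix V V ℝ} (hB : ∀ v w, 0 < B v w) {y : V → ℝ}
    (hy : ∀ v, 0 ≤ y v) (hy0 : y ≠ 0) (v : V) : 0 < (B *ᵥ y) v := by
  obtain ⟨w, hw⟩ := Function.ne_iff.mp hy0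
  exact Finset.sum_pos' (fun w _ => mul_nonneg (hB v w).le (hy w))
    ⟨w, Finset.mem_univ w, mul_pos (hB v w) (lt_of_le_of_ne (hy w) (Ne.symm hw))⟩

/-! ### Exponential convergence of the power method for a positive matrix -/

/-- The contraction behind the power method: one application of a positive matrix `R` with
positive eigenvector `m` shrinks the interval in which the ratios `y v / m v` lie by a fixed
factor. -/
theorem exists_contraction [Nonempty V] {R : Matrix V V ℝ} (hR : ∀ v w, 0 < R v w) {m : V → ℝ}
    (hpos : ∀ v, 0 < m v) {κ : ℝ} (hκ : 0 < κ) (hm : R *ᵥ m = κ • m) :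
    ∃ θ : ℝ, 0 < θ ∧ θ < 1 ∧ ∀ (a b : ℝ) (y : V → ℝ), (∀ v, a * m v ≤ y v) →
      (∀ v, y v ≤ b * m v) → ∃ a' b' : ℝ, a ≤ a' ∧ b' - a' = (1 - θ) * (b - a) ∧
        (∀ v, a' * m v ≤ κ⁻¹ * (R *ᵥ y) v) ∧ ∀ v, κ⁻¹ * (R *ᵥ y) v ≤ b' * m v := by
  obtain ⟨w⟩ := ‹Nonempty V›
  have : Nonempty V := ⟨w⟩
  obtain ⟨v₀, hv₀⟩ := Finite.exists_min fun v => R v w / (κ * m v)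
  -- The factor `1 / 2` makes `θ = ε * m w` strictly smaller than one.
  set ε : ℝ := R v₀ w / (κ * m v₀) / 2 with hεdef
  have hε : 0 < ε := by have := hR v₀ w; have := hpos v₀; positivity
  have hmin : ∀ v, ε * (κ * m v) ≤ R v w := fun v => by
    have h1 := (le_div_iff₀ (mul_pos hκ (hpos v))).mp (hv₀ v)
    have h2 : 0 < ε * (κ * m v) := mul_pos hε (mul_pos hκ (hpos v))
    have h3 : R v₀ w / (κ * m v₀) = 2 * ε := by rw [hεdef]; ring
    rw [h3] at h1
    linarith
  have hθ : ε * m w < 1 := by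
    have h1 : R v₀ w * m w ≤ κ * m v₀ := by
      have h2 : (R *ᵥ m) v₀ = κ * m v₀ := congrFun hm v₀
      rw [← h2]
      exact Finset.single_le_sum (f := fun w => R v₀ w * m w)
        (fun i _ => mul_nonneg (hR v₀ i).le (hpos i).le) (Finset.mem_univ w)
    have h3 : R v₀ w * m w / (κ * m v₀) ≤ 1 := (div_le_one (mul_pos hκ (hpos v₀))).mpr h1
    have h4 : ε * m w = R v₀ w * m w / (κ * m v₀) / 2 := by rw [hεdef]; ring
    linarith
  have key : ∀ z : V → ℝ, (∀ v, 0 ≤ z v) → ∀ v, ε * z w * m v ≤ κ⁻¹ * (R *ᵥ z) v := by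
    intro z hz v
    rw [le_inv_mul_iff₀ hκ]
    refine le_trans ?_ (Finset.single_le_sum (f := fun w => R v w * z w)
      (fun i _ => mul_nonneg (hR v i).le (hz i)) (Finset.mem_univ w))
    have := mul_le_mul_of_nonneg_right (hmin v) (hz w)
    nlinarith
  have hmv : ∀ v, κ⁻¹ * (R *ᵥ m) v = m v := fun v => by
    rw [hm, Pi.smul_apply, smul_eq_mul, inv_mul_cancel_left₀ hκ.ne']
  refine ⟨ε * m w, mul_pos hε (hpos w), hθ, fun a b y ha hb => ?_⟩
  refine ⟨ε * y w + (1 - ε * m w) * a, ε * y w + (1 - ε * m w) * b, ?_, by ring,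
    fun v => ?_, fun v => ?_⟩
  · have := mul_le_mul_of_nonneg_left (ha w) hε.le
    nlinarith
  · have h1 := key (y - a • m) (fun v => by simpa using ha v) v
    rw [Matrix.mulVec_sub, Matrix.mulVec_smul] at h1
    simp only [Pi.sub_apply, Pi.smul_apply, smul_eq_mul] at h1
    have h2 := hmv v
    linear_combination h1 - a * h2
  · have h1 := key (b • m - y) (fun v => by simpa using hb v) v
    rw [Matrix.mulVec_sub, Matrix.mulVec_smul] at h1
    simp only [Pi.sub_apply, Pi.smul_apply, smul_eq_mul] at h1
    have h2 := hmv v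
    linear_combination h1 + b * h2

/-- Exponential convergence of the power method, for iterates normalised to have coordinate sum one.
The estimate is made for the unnormalised iterates, starting from `x 1`, which is positive. -/
theorem normalized_iterate_tendsto_exp [Nonempty V] {R : Matrix V V ℝ} (hR : ∀ v w, 0 < R v w)
    {m : V → ℝ} (hpos : ∀ v, 0 < m v) (hsum : ∑ v, m v = 1) {κ : ℝ} (hκ : 0 < κ)
    (hm : R *ᵥ m = κ • m) {x : ℕ → V → ℝ} (hx : ∀ n v, 0 ≤ x n v) (hx1 : ∀ n, ∑ v, x n v = 1)
    (hrec : ∀ n, x (n + 1) = (∑ v, (R *ᵥ x n) v)⁻¹ • (R *ᵥ x n)) :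
    ∃ C c : ℝ, 0 < C ∧ 0 < c ∧ c < 1 ∧ ∀ n v, |x n v - m v| ≤ C * c ^ n := by
  obtain ⟨θ, hθ0, hθ1, hcontr⟩ := exists_contraction hR hpos hκ hm
  have hx0 : ∀ n, x n ≠ 0 := fun n h => by simpa [h] using hx1 n
  have hRx : ∀ n v, 0 < (R *ᵥ x n) v := fun n => Matrix.mulVec_pos_of_pos hR (hx n) (hx0 n)
  -- After one step all coordinates are positive.
  have hx1pos : ∀ v, 0 < x 1 v := fun v => by
    rw [hrec 0]
    exact mul_pos (inv_pos.mpr (Finset.sum_pos (fun v _ => hRx 0 v) Finset.univ_nonempty)) (hRx 0 v)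
  obtain ⟨va, hva⟩ := Finite.exists_min fun v => x 1 v / m v
  obtain ⟨vb, hvb⟩ := Finite.exists_max fun v => x 1 v / m v
  set a₀ : ℝ := x 1 va / m va
  set b₀ : ℝ := x 1 vb / m vb
  have ha₀ : 0 < a₀ := div_pos (hx1pos va) (hpos va)
  have hab₀ : a₀ ≤ b₀ := hva vb
  -- The unnormalised iterates are trapped between shrinking multiples of `m`.
  have main : ∀ n : ℕ, ∃ (y : V → ℝ) (a b : ℝ), x (n + 1) = (∑ v, y v)⁻¹ • y ∧ a₀ ≤ a ∧
      b - a = (1 - θ) ^ n * (b₀ - a₀) ∧ (∀ v, a * m v ≤ y v) ∧ ∀ v, y v ≤ b * m v := by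
    intro n
    induction n with
    | zero =>
      refine ⟨x 1, a₀, b₀, by rw [hx1 1, inv_one, one_smul], le_rfl, by simp,
        fun v => ?_, fun v => ?_⟩
      · exact (le_div_iff₀ (hpos v)).mp (hva v)
      · exact (div_le_iff₀ (hpos v)).mp (hvb v)
    | succ n ih =>
      obtain ⟨y, a, b, hxy, haa, hba, ha, hb⟩ := ih
      obtain ⟨a', b', haa', hba', ha', hb'⟩ := hcontr a b y ha hb
      refine ⟨κ⁻¹ • (R *ᵥ y), a', b', ?_, haa.trans haa', by rw [hba', hba]; ring, ha', hb'⟩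
      have hy : ∀ v, 0 < y v := fun v => (mul_pos (ha₀.trans_le haa) (hpos v)).trans_le (ha v)
      have hs : (∑ v, y v) ≠ 0 := (Finset.sum_pos (fun v _ => hy v) Finset.univ_nonempty).ne'
      have hs' : (∑ v, (R *ᵥ y) v) ≠ 0 :=
        (Finset.sum_pos (fun v _ => Matrix.mulVec_pos_of_pos hR (fun v => (hy v).le)
          (fun h => hs (by simp [h])) v) Finset.univ_nonempty).ne'
      rw [hrec (n + 1), hxy, Matrix.mulVec_smul]
      ext v
      simp only [Pi.smul_apply, smul_eq_mul, ← Finset.mul_sum]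
      field_simp
  have hx_le : ∀ v, x 0 v ≤ 1 := fun v => by
    rw [← hx1 0]
    exact Finset.single_le_sum (fun i _ => hx 0 i) (Finset.mem_univ v)
  have hm_le : ∀ v, m v ≤ 1 := fun v => by
    rw [← hsum]
    exact Finset.single_le_sum (fun i _ => (hpos i).le) (Finset.mem_univ v)
  have hc : 0 < 1 - θ := by linarith
  have hD : 0 ≤ (b₀ - a₀) / a₀ / (1 - θ) :=
    div_nonneg (div_nonneg (sub_nonneg.mpr hab₀) ha₀.le) hc.le
  refine ⟨(b₀ - a₀) / a₀ / (1 - θ) + 1, 1 - θ, by linarith, hc, by linarith, fun n v => ?_⟩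
  rcases n with _ | n
  · rw [pow_zero, mul_one, abs_le]
    constructor <;> linarith [hx 0 v, hx_le v, hpos v, hm_le v]
  · obtain ⟨y, a, b, hxy, haa, hba, ha, hb⟩ := main n
    set s : ℝ := ∑ v, y v
    have hsa : a ≤ s := by
      rw [← mul_one a, ← hsum, Finset.mul_sum]
      exact Finset.sum_le_sum fun v _ => ha v
    have hsb : s ≤ b := by
      rw [← mul_one b, ← hsum, Finset.mul_sum]
      exact Finset.sum_le_sum fun v _ => hb v
    have hs : 0 < s := ha₀.trans_le (haa.trans hsa)
    have h1 : |y v - s * m v| ≤ b - a := by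
      have h2 : (b - a) * m v ≤ b - a :=
        mul_le_of_le_one_right (by linarith) (hm_le v)
      have h3 := mul_le_mul_of_nonneg_right hsa (hpos v).le
      have h4 := mul_le_mul_of_nonneg_right hsb (hpos v).le
      rw [abs_le]
      constructor <;> nlinarith [ha v, hb v]
    have h5 : x (n + 1) v - m v = (y v - s * m v) / s := by
      rw [hxy, Pi.smul_apply, smul_eq_mul]
      field_simp
    rw [h5, abs_div, abs_of_pos hs]
    have hp : 0 < (1 - θ) ^ n := pow_pos hc n
    calc |y v - s * m v| / s ≤ (b - a) / a₀ :=
          div_le_div₀ (by linarith) h1 ha₀ (haa.trans hsa)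
      _ = (b₀ - a₀) / a₀ / (1 - θ) * (1 - θ) ^ (n + 1) := by
          rw [hba, pow_succ]
          field_simp
      _ ≤ ((b₀ - a₀) / a₀ / (1 - θ) + 1) * (1 - θ) ^ (n + 1) :=
          mul_le_mul_of_nonneg_right (by linarith) (pow_pos hc _).le

/-! ### The Perron–Frobenius theorem for irreducible nonnegative matrices -/

variable [DecidableEq V]

theorem Matrix.pow_nonneg_of_nonneg {B : Matrix V V ℝ} (hB : ∀ v w, 0 ≤ B v w) (k : ℕ) (v w : V) :
    0 ≤ (B ^ k) v w := by
  induction k generalizing v w with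
  | zero => rw [pow_zero, Matrix.one_apply]; split_ifs <;> norm_num
  | succ k ih =>
    rw [pow_succ, Matrix.mul_apply]
    exact Finset.sum_nonneg fun i _ => mul_nonneg (ih v i) (hB i w)

theorem Matrix.pow_mulVec_of_eigenvector {B : Matrix V V ℝ} {m : V → ℝ} {t : ℝ}
    (hm : B *ᵥ m = t • m) (k : ℕ) : (B ^ k) *ᵥ m = t ^ k • m := by
  induction k with
  | zero => simp
  | succ k ih =>
    rw [pow_succ, ← Matrix.mulVec_mulVec, hm, Matrix.mulVec_smul, ih, smul_smul, pow_succ']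

/-- A nonnegative matrix with a positive eigenvector has the corresponding eigenvalue as its
spectral radius: if `z` is a complex eigenvector for `l`, then comparing `|z|` with the smallest
multiple of `m` that dominates it gives `|l| ≤ t`. -/
theorem matrixSpectralRadius_eq_of_pos_eigenvector [Nonempty V] {B : Matrix V V ℝ}
    (hB : ∀ v w, 0 ≤ B v w) {m : V → ℝ} (hpos : ∀ v, 0 < m v) {t : ℝ} (hm : B *ᵥ m = t • m) :
    matrixSpectralRadius B = ENNReal.ofReal t := by
  have hmv : ∀ v, ∑ w, B v w * m w = t * m v := fun v => congrFun hm v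
  have ht : 0 ≤ t := by
    obtain ⟨v⟩ := ‹Nonempty V›
    have h1 : 0 ≤ t * m v :=
      (hmv v) ▸ Finset.sum_nonneg fun w _ => mul_nonneg (hB v w) (hpos w).le
    exact nonneg_of_mul_nonneg_left h1 (hpos v)
  rw [matrixSpectralRadius, spectralRadius]
  apply le_antisymm
  · refine iSup₂_le fun l hl => ?_
    rw [← Matrix.spectrum_toLin', ← Module.End.hasEigenvalue_iff_mem_spectrum] at hl
    obtain ⟨z, hz⟩ := hl.exists_hasEigenvector
    have hz0 : z ≠ 0 := hz.2
    have hzl : ∀ v, ∑ w, (B v w : ℂ) * z w = l * z v := fun v => congrFun hz.apply_eq_smul v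
    obtain ⟨v, hv⟩ := Finite.exists_max fun v => ‖z v‖ / m v
    obtain ⟨w, hw⟩ := Function.ne_iff.mp hz0
    have hc : 0 < ‖z v‖ / m v :=
      (div_pos (norm_pos_iff.mpr hw) (hpos w)).trans_le (hv w)
    have hzv : 0 < ‖z v‖ := by
      have := mul_pos hc (hpos v)
      rwa [div_mul_cancel₀ _ (hpos v).ne'] at this
    have h1 : ‖l‖ * ‖z v‖ ≤ t * ‖z v‖ := calc
      ‖l‖ * ‖z v‖ = ‖∑ w, (B v w : ℂ) * z w‖ := by rw [hzl, norm_mul]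
      _ ≤ ∑ w, ‖(B v w : ℂ) * z w‖ := norm_sum_le _ _
      _ ≤ ∑ w, ‖z v‖ / m v * (B v w * m w) := by
        refine Finset.sum_le_sum fun w _ => ?_
        rw [norm_mul, Complex.norm_real, Real.norm_of_nonneg (hB v w), mul_left_comm]
        exact mul_le_mul_of_nonneg_left ((div_le_iff₀ (hpos w)).mp (hv w)) (hB v w)
      _ = t * ‖z v‖ := by
        rw [← Finset.mul_sum, hmv]
        field_simp [(hpos v).ne']
    rw [← ENNReal.ofReal_coe_nnreal, coe_nnnorm]
    exact ENNReal.ofReal_le_ofReal (le_of_mul_le_mul_right h1 hzv)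
  · have hmem : (t : ℂ) ∈ spectrum ℂ (B.map fun a : ℝ => (a : ℂ)) := by
      rw [← Matrix.spectrum_toLin', ← Module.End.hasEigenvalue_iff_mem_spectrum]
      refine Module.End.hasEigenvalue_of_hasEigenvector (x := fun v => (m v : ℂ)) ⟨?_, ?_⟩
      · rw [Module.End.mem_eigenspace_iff]
        ext v
        change ∑ w, (B v w : ℂ) * (m w : ℂ) = (t : ℂ) * (m v : ℂ)
        exact_mod_cast hmv v
      · obtain ⟨v⟩ := ‹Nonempty V›
        exact Function.ne_iff.mpr ⟨v, by simpa using (hpos v).ne'⟩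
    refine le_trans (le_of_eq ?_) (le_iSup₂ (f := fun (k : ℂ) _ => (‖k‖₊ : ℝ≥0∞)) _ hmem)
    rw [← ENNReal.ofReal_coe_nnreal, coe_nnnorm, Complex.norm_real, Real.norm_of_nonneg ht]

/-- An irreducible matrix commutes with an entrywise positive matrix, namely a sum of its powers,
which has every eigenvector of the given matrix as an eigenvector. -/
theorem exists_pos_commute {A : Matrix V V ℝ} (hA : ∀ v w, 0 ≤ A v w)
    (hirr : ∀ v w, ∃ k : ℕ, 0 < (A ^ k) v w) :
    ∃ P : Matrix V V ℝ, (∀ v w, 0 < P v w) ∧ A * P = P * A ∧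
      ∀ (y : V → ℝ) (t : ℝ), A *ᵥ y = t • y → ∃ s : ℝ, P *ᵥ y = s • y := by
  choose k hk using hirr
  refine ⟨∑ i : V × V, A ^ k i.1 i.2, fun v w => ?_, ?_, fun y t hy => ?_⟩
  · rw [Matrix.sum_apply]
    exact Finset.sum_pos' (fun i _ => Matrix.pow_nonneg_of_nonneg hA _ _ _)
      ⟨(v, w), Finset.mem_univ _, hk v w⟩
  · rw [Finset.mul_sum, Finset.sum_mul]
    exact Finset.sum_congr rfl fun i _ => (Commute.self_pow A _).eq
  · refine ⟨∑ i : V × V, t ^ k i.1 i.2, ?_⟩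
    rw [Matrix.sum_mulVec, Finset.sum_smul]
    exact Finset.sum_congr rfl fun i _ => Matrix.pow_mulVec_of_eigenvector hy _

/-- Existence in the Perron–Frobenius theorem: the supremum of the `t` with `t x ≤ A x` for some
`x` in the simplex is attained, and at a maximum the inequality is an equality. -/
theorem exists_pos_eigenvector [Nonempty V] {A : Matrix V V ℝ} (hA : ∀ v w, 0 ≤ A v w)
    (hirr : ∀ v w, ∃ k : ℕ, 0 < (A ^ k) v w) :
    ∃ (t : ℝ) (m : V → ℝ), (∀ v, 0 < m v) ∧ ∑ v, m v = 1 ∧ A *ᵥ m = t • m := by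
  obtain ⟨P, hP, hcomm, heig⟩ := exists_pos_commute hA hirr
  let C : ℝ := ∑ v, ∑ w, A v w
  let K : Set ((V → ℝ) × ℝ) :=
    (stdSimplex ℝ V ×ˢ Set.Icc 0 C) ∩ {p | ∀ v, p.2 * p.1 v ≤ (A *ᵥ p.1) v}
  have hbound : ∀ (x : V → ℝ) (t : ℝ), x ∈ stdSimplex ℝ V → (∀ v, t * x v ≤ (A *ᵥ x) v) →
      t ≤ C := fun x t hx h => calc
    t = ∑ v, t * x v := by rw [← Finset.mul_sum, hx.2, mul_one]
    _ ≤ ∑ v, (A *ᵥ x) v := Finset.sum_le_sum fun v _ => h v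
    _ ≤ C := by
      refine Finset.sum_le_sum fun v _ => Finset.sum_le_sum fun w _ => ?_
      refine mul_le_of_le_one_right (hA v w) ?_
      rw [← hx.2]
      exact Finset.single_le_sum (fun i _ => hx.1 i) (Finset.mem_univ w)
  have hK : IsCompact K := by
    refine ((isCompact_stdSimplex ℝ V).prod isCompact_Icc).inter_right ?_
    simp only [Set.ofPred_forall]
    refine isClosed_iInter fun v => isClosed_le ?_ ?_
    · fun_prop
    · exact (continuous_apply v).comp (Continuous.matrix_mulVec continuous_const continuous_fst)
  have hKne : K.Nonempty := by
    obtain ⟨v⟩ := ‹Nonempty V›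
    refine ⟨(Pi.single v 1, 0), ⟨single_mem_stdSimplex ℝ v, le_rfl, ?_⟩, fun w => ?_⟩
    · exact Finset.sum_nonneg fun v _ => Finset.sum_nonneg fun w _ => hA v w
    · rw [zero_mul]
      exact Matrix.mulVec_nonneg_of_nonneg hA (single_mem_stdSimplex ℝ v).1 w
  obtain ⟨⟨x, t⟩, ⟨⟨hx, ht⟩, hxt⟩, hmax⟩ := hK.exists_isMaxOn hKne continuous_snd.continuousOn
  simp only [Set.mem_ofPred_eq] at hx ht hxt
  have hx0 : x ≠ 0 := by
    rintro rfl
    simpa using hx.2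
  have hAx : A *ᵥ x = t • x := by
    by_contra hne
    have hy : ∀ v, 0 < (P *ᵥ (A *ᵥ x - t • x)) v :=
      Matrix.mulVec_pos_of_pos hP (fun v => by simpa using hxt v) (sub_ne_zero.mpr hne)
    have hx' : ∀ v, 0 < (P *ᵥ x) v := Matrix.mulVec_pos_of_pos hP hx.1 hx0
    obtain ⟨v₀, hv₀⟩ := Finite.exists_min fun v => (P *ᵥ (A *ᵥ x - t • x)) v / (P *ᵥ x) v
    set ε : ℝ := (P *ᵥ (A *ᵥ x - t • x)) v₀ / (P *ᵥ x) v₀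
    have hε : 0 < ε := div_pos (hy v₀) (hx' v₀)
    have hineq : ∀ v, (t + ε) * (P *ᵥ x) v ≤ (A *ᵥ (P *ᵥ x)) v := fun v => by
      have h1 := (le_div_iff₀ (hx' v)).mp (hv₀ v)
      rw [Matrix.mulVec_sub, Matrix.mulVec_smul, Matrix.mulVec_mulVec, ← hcomm] at h1
      rw [Matrix.mulVec_mulVec]
      simp only [Pi.sub_apply, Pi.smul_apply, smul_eq_mul] at h1
      linarith
    let σ : ℝ := ∑ v, (P *ᵥ x) v
    have hσ : 0 < σ := Finset.sum_pos (fun v _ => hx' v) Finset.univ_nonempty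
    have hmem : σ⁻¹ • (P *ᵥ x) ∈ stdSimplex ℝ V := by
      refine ⟨fun v => mul_nonneg (inv_nonneg.mpr hσ.le) (hx' v).le, ?_⟩
      simp only [Pi.smul_apply, smul_eq_mul]
      rw [← Finset.mul_sum]
      exact inv_mul_cancel₀ hσ.ne'
    have hle : ∀ v, (t + ε) * (σ⁻¹ • (P *ᵥ x)) v ≤ (A *ᵥ (σ⁻¹ • (P *ᵥ x))) v := fun v => by
      rw [Matrix.mulVec_smul, Pi.smul_apply, Pi.smul_apply, smul_eq_mul, smul_eq_mul,
        mul_left_comm]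
      exact mul_le_mul_of_nonneg_left (hineq v) (inv_nonneg.mpr hσ.le)
    have h3 : t + ε ≤ t := hmax (a := (σ⁻¹ • (P *ᵥ x), t + ε))
      ⟨⟨hmem, add_nonneg ht.1 hε.le, hbound _ _ hmem hle⟩, hle⟩
    linarith
  refine ⟨t, x, fun v => lt_of_le_of_ne (hx.1 v) fun h0 => ?_, hx.2, hAx⟩
  obtain ⟨s, hs⟩ := heig x t hAx
  have h1 := Matrix.mulVec_pos_of_pos hP hx.1 hx0 v
  rw [hs, Pi.smul_apply, ← h0, smul_zero] at h1
  exact lt_irrefl _ h1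

/-- Uniqueness in the Perron–Frobenius theorem: subtract from `m'` the largest multiple of `m`
that leaves it nonnegative. -/
theorem pos_eigenvector_unique [Nonempty V] {A : Matrix V V ℝ} (hA : ∀ v w, 0 ≤ A v w)
    (hirr : ∀ v w, ∃ k : ℕ, 0 < (A ^ k) v w) {t : ℝ} {m m' : V → ℝ} (hpos : ∀ v, 0 < m v)
    (hsum : ∑ v, m v = 1) (hm : A *ᵥ m = t • m) (hsum' : ∑ v, m' v = 1) (hm' : A *ᵥ m' = t • m') :
    m' = m := by
  obtain ⟨P, hP, -, heig⟩ := exists_pos_commute hA hirr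
  obtain ⟨v₀, hv₀⟩ := Finite.exists_min fun v => m' v / m v
  set c : ℝ := m' v₀ / m v₀ with hc
  have hz : ∀ v, 0 ≤ (m' - c • m) v := fun v => by
    have := (le_div_iff₀ (hpos v)).mp (hv₀ v)
    simpa using this
  have hz0 : (m' - c • m) v₀ = 0 := by
    simp [hc, div_mul_cancel₀ _ (hpos v₀).ne']
  have hzeig : A *ᵥ (m' - c • m) = t • (m' - c • m) := by
    rw [Matrix.mulVec_sub, Matrix.mulVec_smul, hm, hm', smul_sub, smul_comm]
  have h0 : m' - c • m = 0 := by
    by_contra hne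
    obtain ⟨s, hs⟩ := heig _ t hzeig
    have h1 := Matrix.mulVec_pos_of_pos hP hz hne v₀
    rw [hs, Pi.smul_apply, hz0, smul_zero] at h1
    exact lt_irrefl _ h1
  have h1 : m' = c • m := sub_eq_zero.mp h0
  have h2 : c = 1 := by
    rw [h1] at hsum'
    simpa [← Finset.mul_sum, hsum] using hsum'
  rw [h1, h2, one_smul]

/-! ### The Neumann series of a nonnegative matrix -/

/-- The Neumann series of a nonnegative matrix `B` converges if `B` has a positive eigenvector `m`
with an eigenvalue `q < 1`, because `(B ^ k) v w ≤ q ^ k * (m v / m w)`. -/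
theorem hasSum_pow_apply_of_pos_eigenvector {B : Matrix V V ℝ} (hB : ∀ v w, 0 ≤ B v w)
    {m : V → ℝ} (hpos : ∀ v, 0 < m v) {q : ℝ} (hq0 : 0 ≤ q) (hq : q < 1) (hm : B *ᵥ m = q • m) :
    IsUnit (1 - B) ∧ ∀ v w, HasSum (fun k : ℕ => (B ^ k) v w) ((1 - B)⁻¹ v w) := by
  have hle : ∀ (k : ℕ) (v w : V), (B ^ k) v w ≤ q ^ k * (m v / m w) := fun k v w => by
    rw [← mul_div_assoc, le_div_iff₀ (hpos w)]
    have h1 : ((B ^ k) *ᵥ m) v = q ^ k * m v :=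
      congrFun (Matrix.pow_mulVec_of_eigenvector hm k) v
    rw [← h1]
    exact Finset.single_le_sum (f := fun w => (B ^ k) v w * m w)
      (fun i _ => mul_nonneg (Matrix.pow_nonneg_of_nonneg hB k v i) (hpos i).le)
      (Finset.mem_univ w)
  have hs : Summable fun k : ℕ => B ^ k := by
    refine Pi.summable.mpr fun v => Pi.summable.mpr fun w => ?_
    exact Summable.of_nonneg_of_le (fun k => Matrix.pow_nonneg_of_nonneg hB k v w)
      (fun k => hle k v w) ((summable_geometric_of_lt_one hq0 hq).mul_right _)
  have h1 : (1 - B) * ∑' k : ℕ, B ^ k = 1 := hs.one_sub_mul_tsum_pow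
  refine ⟨IsUnit.of_mul_eq_one _ h1, fun v w => ?_⟩
  rw [Matrix.inv_eq_right_inv h1]
  exact Pi.hasSum.mp (Pi.hasSum.mp hs.hasSum v) w

end NonnegMatrix

/-! ### Counting paths -/

namespace DirGraph

variable {V D : Type u} (E : DirGraph V D)

theorem mem_paths [Finite D] {v : V} {k : ℕ} {μ : E.Path v} :
    μ ∈ E.paths v k ↔ μ.edges.length = k :=
  Set.Finite.mem_toFinset _

theorem adj_nonneg (v w : V) : 0 ≤ E.adj v w :=
  Nat.cast_nonneg _

variable [Fintype D]

theorem sum_paths_succ {M : Type*} [AddCommMonoid M] [DecidableEq V] (f : V → M) (v : V) (k : ℕ) :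
    ∑ μ ∈ E.paths v (k + 1), f μ.source =
      ∑ e : {e : D // E.r e = v}, ∑ μ ∈ E.paths (E.s e) k, f μ.source := by
  rw [Finset.sum_sigma']
  symm
  refine Finset.sum_bij (fun p _ => (⟨p.1.1 :: p.2.edges, p.1.2, p.2.2⟩ : E.Path v)) ?_ ?_ ?_ ?_
  · rintro ⟨e, μ⟩ h
    rw [Finset.mem_sigma, mem_paths] at h
    rw [mem_paths]
    exact congrArg (· + 1) h.2
  · rintro ⟨⟨e, he⟩, ⟨l, hl⟩⟩ - ⟨⟨e', he'⟩, ⟨l', hl'⟩⟩ - h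
    obtain ⟨rfl, h2⟩ := List.cons.inj (congrArg Subtype.val h)
    obtain rfl : l = l' := h2
    rfl
  · rintro ⟨_ | ⟨e, l⟩, hl⟩ h
    · rw [mem_paths] at h
      exact absurd h (Nat.succ_ne_zero k).symm
    · rw [mem_paths] at h
      exact ⟨⟨⟨e, hl.1⟩, ⟨l, hl.2⟩⟩, Finset.mem_sigma.mpr ⟨Finset.mem_univ _,
        (E.mem_paths).mpr (Nat.succ_injective h)⟩, rfl⟩
  · rintro ⟨e, μ⟩ -
    rfl

variable [Fintype V] [DecidableEq V]

theorem adj_mulVec (f : V → ℝ) (v : V) :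
    (E.adj *ᵥ f) v = ∑ e : {e : D // E.r e = v}, f (E.s e) := by
  rw [← Finset.sum_fiberwise (g := fun e : {e : D // E.r e = v} => E.s e)]
  refine Finset.sum_congr rfl fun w _ => ?_
  have hcard : Nat.card {e : D // E.r e = v ∧ E.s e = w} =
      (Finset.univ.filter fun e : {e : D // E.r e = v} => E.s e = w).card := by
    rw [← Fintype.card_subtype, ← Nat.card_eq_fintype_card]
    exact Nat.card_congr (Equiv.subtypeSubtypeEquivSubtypeInter
      (fun e => E.r e = v) (fun e => E.s e = w)).symm
  rw [Finset.sum_congr rfl (g := fun _ => f w) fun e he => by rw [(Finset.mem_filter.mp he).2],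
    Finset.sum_const, nsmul_eq_mul, ← hcard]
  rfl

/-- Sums over paths of a function of their source are given by powers of the adjacency matrix. -/
theorem sum_paths (f : V → ℝ) (v : V) (k : ℕ) :
    ∑ μ ∈ E.paths v k, f μ.source = ((E.adj ^ k) *ᵥ f) v := by
  induction k generalizing v with
  | zero =>
    have h : E.paths v 0 = {⟨[], trivial⟩} := by
      ext μ
      rw [mem_paths, Finset.mem_singleton, List.length_eq_zero_iff]
      exact ⟨fun h => Subtype.ext h, fun h => congrArg Subtype.val h⟩
    rw [h, Finset.sum_singleton, pow_zero, Matrix.one_mulVec]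
    rfl
  | succ k ih =>
    rw [sum_paths_succ, pow_succ', ← Matrix.mulVec_mulVec, adj_mulVec]
    exact Finset.sum_congr rfl fun e _ => ih _

theorem exists_adj_pow_pos (hE : E.StronglyConnected) (v w : V) : ∃ k : ℕ, 0 < (E.adj ^ k) v w := by
  obtain ⟨μ, hμ⟩ := hE v w
  refine ⟨μ.edges.length, ?_⟩
  have h := E.sum_paths (Pi.single w 1) v μ.edges.length
  have h' : ((E.adj ^ μ.edges.length) *ᵥ Pi.single w 1) v = (E.adj ^ μ.edges.length) v w :=
    congrFun (Matrix.mulVec_single_one (E.adj ^ μ.edges.length) w) v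
  rw [← h', ← h]
  refine Finset.sum_pos' (fun ν _ => ?_) ⟨μ, E.mem_paths.mpr rfl, ?_⟩
  · exact (Pi.single_nonneg.mpr zero_le_one : (0 : V → ℝ) ≤ Pi.single w 1) _
  · rw [hμ, Pi.single_eq_same]
    exact one_pos

/-! ### The resolvent of the adjacency matrix -/

/-- All that is needed about `A_E`: its Perron–Frobenius eigenvector `m`, the eigenvalue `κ` of
`(I - e^{-β} A_E)⁻¹` at `m`, and the Neumann series of that matrix, whose entries are positive. -/
theorem resolvent_adj [Nonempty V] (hE : E.StronglyConnected) {β : ℝ}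
    (hβ : ENNReal.log (matrixSpectralRadius E.adj) < (β : EReal)) :
    (∃! m : V → ℝ, IsPerronFrobenius E.adj m) ∧ IsUnit (1 - Real.exp (-β) • E.adj) ∧
    (∀ v w, HasSum (fun k : ℕ => Real.exp (-β * k) * (E.adj ^ k) v w)
      (resolventMatrix E.adj β v w)) ∧
    (∀ v w, 0 < resolventMatrix E.adj β v w) ∧
    ∃ κ : ℝ, 0 < κ ∧ matrixSpectralRadius (resolventMatrix E.adj β) = ENNReal.ofReal κ ∧
      ∀ m, IsPerronFrobenius E.adj m → resolventMatrix E.adj β *ᵥ m = κ • m := by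
  have hA := E.adj_nonneg
  have hirr := E.exists_adj_pow_pos hE
  obtain ⟨t, m, hpos, hsum, hm⟩ := exists_pos_eigenvector hA hirr
  have hρ := matrixSpectralRadius_eq_of_pos_eigenvector hA hpos hm
  have ht : 0 ≤ t := by
    obtain ⟨v⟩ := ‹Nonempty V›
    have h1 : (E.adj *ᵥ m) v = t * m v := congrFun hm v
    exact nonneg_of_mul_nonneg_left
      (h1 ▸ Matrix.mulVec_nonneg_of_nonneg hA (fun v => (hpos v).le) v) (hpos v)
  have htρ : (matrixSpectralRadius E.adj).toReal = t := by rw [hρ, ENNReal.toReal_ofReal ht]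
  have hPF : IsPerronFrobenius E.adj m := ⟨hpos, hsum, by rw [htρ]; exact hm⟩
  have huniq : ∀ m', IsPerronFrobenius E.adj m' → m' = m := fun m' h' =>
    pos_eigenvector_unique hA hirr hpos hsum hm h'.sum_eq_one (by rw [← htρ]; exact h'.mulVec_eq)
  set B : Matrix V V ℝ := Real.exp (-β) • E.adj with hBdef
  have hB : ∀ v w, 0 ≤ B v w := fun v w => mul_nonneg (Real.exp_pos _).le (hA v w)
  have hBm : B *ᵥ m = (Real.exp (-β) * t) • m := by
    rw [hBdef, Matrix.smul_mulVec, hm, smul_smul]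
  have hq0 : 0 ≤ Real.exp (-β) * t := mul_nonneg (Real.exp_pos _).le ht
  have hq : Real.exp (-β) * t < 1 := by
    have h1 : t < Real.exp β := by
      rw [← ENNReal.ofReal_lt_ofReal_iff (Real.exp_pos β), ← hρ]
      rw [← ENNReal.log_lt_log_iff, ENNReal.log_ofReal_of_pos (Real.exp_pos β), Real.log_exp]
      exact hβ
    calc Real.exp (-β) * t < Real.exp (-β) * Real.exp β :=
          mul_lt_mul_of_pos_left h1 (Real.exp_pos _)
      _ = 1 := by rw [← Real.exp_add]; simp
  obtain ⟨hunit, hs⟩ := hasSum_pow_apply_of_pos_eigenvector hB hpos hq0 hq hBm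
  have hBk : ∀ (k : ℕ) v w, (B ^ k) v w = Real.exp (-β * k) * (E.adj ^ k) v w := fun k v w => by
    rw [hBdef, smul_pow, Matrix.smul_apply, smul_eq_mul, ← Real.exp_nat_mul, mul_comm (k : ℝ)]
  have hR : ∀ v w, 0 < resolventMatrix E.adj β v w := fun v w => by
    obtain ⟨k, hk⟩ := hirr v w
    refine lt_of_lt_of_le ?_ (le_hasSum (hs v w) k fun j _ => Matrix.pow_nonneg_of_nonneg hB j v w)
    rw [hBk]
    exact mul_pos (Real.exp_pos _) hk
  have hκ : 0 < (1 - Real.exp (-β) * t)⁻¹ := inv_pos.mpr (sub_pos.mpr hq)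
  have hRm : resolventMatrix E.adj β *ᵥ m = (1 - Real.exp (-β) * t)⁻¹ • m := by
    have h1 : (1 - B) *ᵥ m = (1 - Real.exp (-β) * t) • m := by
      rw [Matrix.sub_mulVec, Matrix.one_mulVec, hBm, sub_smul, one_smul]
    have h2 : (1 - B)⁻¹ *ᵥ ((1 - B) *ᵥ m) = m := by
      rw [Matrix.mulVec_mulVec,
        Matrix.nonsing_inv_mul _ ((Matrix.isUnit_iff_isUnit_det _).mp hunit), Matrix.one_mulVec]
    rw [h1, Matrix.mulVec_smul] at h2
    change (1 - B)⁻¹ *ᵥ m = _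
    rw [← h2, smul_smul, h2, inv_mul_cancel₀ (sub_pos.mpr hq).ne', one_smul]
  refine ⟨⟨m, hPF, huniq⟩, hunit, fun v w => ?_, hR, _, hκ,
    matrixSpectralRadius_eq_of_pos_eigenvector (fun v w => (hR v w).le) hpos hRm,
    fun m' h' => ?_⟩
  · simp only [← hBk]
    exact hs v w
  · rw [huniq m' h']
    exact hRm

end DirGraph

noncomputable section

/-! ### States of C⋆-algebras and traces on groupoid C⋆-algebras -/

/-- A state as a positive linear map, for the order given by the positive elements. -/
def CStarState.toPositiveLinearMap {A : Type u} [CStarAlgebra A] [PartialOrder A]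
    [StarOrderedRing A] (φ : CStarState A) : A →ₚ[ℂ] ℂ :=
  PositiveLinearMap.mk₀ φ.toLinearMap fun a ha => by
    obtain ⟨b, rfl⟩ := CStarAlgebra.nonneg_iff_eq_star_mul_self.mp ha
    exact φ.nonneg b

theorem CStarState.continuous {A : Type u} [CStarAlgebra A] (φ : CStarState A) :
    Continuous φ.toLinearMap := by
  let _ : PartialOrder A := CStarAlgebra.spectralOrder A
  have : StarOrderedRing A := CStarAlgebra.spectralOrderedRing A
  exact map_continuous φ.toPositiveLinearMap

theorem CStarTrace.ext_toLinearMap {A : Type u} [CStarAlgebra A] {τ τ' : CStarTrace A}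
    (h : τ.toLinearMap = τ'.toLinearMap) : τ = τ' := by
  obtain ⟨⟨f, _, _⟩, _⟩ := τ
  obtain ⟨⟨f', _, _⟩, _⟩ := τ'
  obtain rfl : f = f' := h
  rfl

namespace GroupoidCStar

variable {V : Type u} [Groupoid.{u} V] [Fintype V]

theorem mul_mem_span_gen {a b : GroupoidCStar V}
    (ha : a ∈ Submodule.span ℂ (Set.range (UniversalCStar.gen : GroupoidElt V → GroupoidCStar V)))
    (hb : b ∈ Submodule.span ℂ (Set.range (UniversalCStar.gen : GroupoidElt V → GroupoidCStar V))) :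
    a * b ∈ Submodule.span ℂ
      (Set.range (UniversalCStar.gen : GroupoidElt V → GroupoidCStar V)) := by
  have h := Submodule.mul_mem_mul ha hb
  rw [Submodule.span_mul_span] at h
  refine Submodule.span_le.mpr ?_ h
  rintro _ ⟨_, ⟨⟨x, y, g⟩, rfl⟩, _, ⟨⟨x', y', h⟩, rfl⟩, rfl⟩
  by_cases hxy : x = y'
  · subst hxy
    exact Submodule.subset_span ⟨elt (h ≫ g), ((isGroupoidRep V).mul g h).symm⟩
  · have h0 := (isGroupoidRep V).mul_of_ne g h hxy
    simp only [SetLike.mem_coe]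
    exact h0 ▸ Submodule.zero_mem _

theorem mem_span_gen_of_mem_adjoin {a : GroupoidCStar V}
    (ha : a ∈ StarAlgebra.adjoin ℂ
      (Set.range (UniversalCStar.gen : GroupoidElt V → GroupoidCStar V))) :
    a ∈ Submodule.span ℂ (Set.range (UniversalCStar.gen : GroupoidElt V → GroupoidCStar V)) := by
  induction ha using StarAlgebra.adjoin_induction with
  | mem x hx => exact Submodule.subset_span hx
  | algebraMap r =>
    rw [Algebra.algebraMap_eq_smul_one, ← (isGroupoidRep V).sum_unit]
    exact Submodule.smul_mem _ _ (Submodule.sum_mem _ fun x _ => Submodule.subset_span ⟨_, rfl⟩)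
  | add x y _ _ hx hy => exact Submodule.add_mem _ hx hy
  | mul x y _ _ hx hy => exact mul_mem_span_gen hx hy
  | star x hx' hx =>
    clear hx'
    induction hx using Submodule.span_induction with
    | mem x hx =>
      obtain ⟨⟨x, y, g⟩, rfl⟩ := hx
      exact Submodule.subset_span ⟨elt (Groupoid.inv g), (isGroupoidRep V).inv g⟩
    | zero => simp
    | add x y _ _ hx hy => rw [star_add]; exact Submodule.add_mem _ hx hy
    | smul c x _ hx => rw [star_smul]; exact Submodule.smul_mem _ _ hx

/-- Continuous functionals are determined by their values on the `u_g`, whose linear span is dense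
since it is closed under products and adjoints and contains the identity. -/
theorem linearMap_ext {φ ψ : GroupoidCStar V →ₗ[ℂ] ℂ} (hφ : Continuous φ) (hψ : Continuous ψ)
    (h : ∀ {x y : V} (g : x ⟶ y), φ (u g) = ψ (u g)) : φ = ψ := by
  refine DFunLike.coe_injective (Continuous.ext_on UniversalCStar.dense_adjoin_gen hφ hψ ?_)
  intro a ha
  refine LinearMap.eqOn_span ?_ (mem_span_gen_of_mem_adjoin ha)
  rintro _ ⟨⟨x, y, g⟩, rfl⟩
  exact h g

theorem map_mul_comm_of_u {φ : GroupoidCStar V →ₗ[ℂ] ℂ} (hφ : Continuous φ)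
    (h : ∀ {x y x' y' : V} (g : x ⟶ y) (k : x' ⟶ y'), φ (u g * u k) = φ (u k * u g))
    (a b : GroupoidCStar V) : φ (a * b) = φ (b * a) := by
  have h1 : ∀ {x y : V} (g : x ⟶ y) (b : GroupoidCStar V), φ (u g * b) = φ (b * u g) :=
    fun g b => LinearMap.congr_fun
      (linearMap_ext (φ := φ ∘ₗ LinearMap.mulLeft ℂ (u g)) (ψ := φ ∘ₗ LinearMap.mulRight ℂ (u g))
        (hφ.comp (continuous_const_mul _)) (hφ.comp (continuous_mul_const _)) fun k => h g k) b
  exact LinearMap.congr_fun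
      (linearMap_ext (φ := φ ∘ₗ LinearMap.mulRight ℂ b) (ψ := φ ∘ₗ LinearMap.mulLeft ℂ b)
        (hφ.comp (continuous_mul_const _)) (hφ.comp (continuous_const_mul _)) fun k => h1 k b) a

theorem star_u_mul_u {x y : V} (g : x ⟶ y) : star (u g) * u g = u (𝟙 x) := by
  rw [u, ← (isGroupoidRep V).inv, (isGroupoidRep V).mul, Groupoid.comp_inv]
  rfl

theorem u_eq_of_elt_eq {x y x' y' : V} {g : x ⟶ y} {k : x' ⟶ y'} (h : elt g = elt k) :
    u g = u k := by
  rw [u, h]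
  rfl

theorem u_mul_u {x y z : V} (g : y ⟶ z) (h : x ⟶ y) : u g * u h = u (h ≫ g) :=
  (isGroupoidRep V).mul g h

theorem u_mul_u_of_ne {x y y' z : V} (g : y' ⟶ z) (h : x ⟶ y) (hne : y' ≠ y) : u g * u h = 0 :=
  (isGroupoidRep V).mul_of_ne g h hne

end GroupoidCStar

namespace CStarTrace

variable {V : Type u} [Groupoid.{u} V] [Fintype V] (τ : CStarTrace (GroupoidCStar V))

/-- The vector `x^τ = (τ(u_v))_v`, as a real vector. -/
def weight (v : V) : ℝ := (τ (GroupoidCStar.u (𝟙 v))).re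

theorem apply_u_id (v : V) : τ (GroupoidCStar.u (𝟙 v)) = (τ.weight v : ℂ) := by
  have h := τ.nonneg (GroupoidCStar.u (𝟙 v))
  rw [GroupoidCStar.star_u_mul_u] at h
  exact Complex.eq_re_of_ofReal_le h

theorem weight_nonneg (v : V) : 0 ≤ τ.weight v := by
  have h := τ.nonneg (GroupoidCStar.u (𝟙 v))
  rw [GroupoidCStar.star_u_mul_u] at h
  exact (Complex.le_def.mp h).1

theorem sum_weight : ∑ v, τ.weight v = 1 := by
  have h := τ.map_one
  rw [← (GroupoidCStar.isGroupoidRep V).sum_unit, map_sum] at h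
  have h' := congrArg Complex.re h
  rw [Complex.re_sum] at h'
  exact h'

end CStarTrace

/-! ### The partition function -/

section Partition

theorem hasSum_pow_mulVec {V D : Type u} [Fintype V] [DecidableEq V] (E : DirGraph V D)
    {β : ℝ} {R : Matrix V V ℝ}
    (hR : ∀ v w, HasSum (fun k : ℕ => Real.exp (-β * k) * (E.adj ^ k) v w) (R v w))
    (x : V → ℝ) (v : V) :
    HasSum (fun k : ℕ => Real.exp (-β * k) * ((E.adj ^ k) *ᵥ x) v) ((R *ᵥ x) v) := by
  have h : ∀ k : ℕ, Real.exp (-β * k) * ((E.adj ^ k) *ᵥ x) v =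
      ∑ w, Real.exp (-β * k) * (E.adj ^ k) v w * x w := fun k => by
    change _ * ∑ w, (E.adj ^ k) v w * x w = _
    rw [Finset.mul_sum]
    exact Finset.sum_congr rfl fun w _ => (mul_assoc _ _ _).symm
  simp only [h]
  exact hasSum_sum (s := Finset.univ) fun w _ => (hR v w).mul_right (x w)

variable {V D : Type u} [Groupoid.{u} V] [Fintype V] [DecidableEq V] [Fintype D]
  (E : DirGraph V D)

theorem sum_paths_trace (τ : CStarTrace (GroupoidCStar V)) (v : V) (k : ℕ) :
    ∑ μ ∈ E.paths v k, τ (GroupoidCStar.u (𝟙 μ.source)) =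
      (((E.adj ^ k) *ᵥ τ.weight) v : ℂ) := by
  rw [← E.sum_paths, Complex.ofReal_sum]
  exact Finset.sum_congr rfl fun μ _ => τ.apply_u_id _

theorem hasSum_partitionTerm {β : ℝ} {R : Matrix V V ℝ}
    (hR : ∀ v w, HasSum (fun k : ℕ => Real.exp (-β * k) * (E.adj ^ k) v w) (R v w))
    (τ : CStarTrace (GroupoidCStar V)) :
    HasSum (partitionTerm E β τ) ((∑ v, (R *ᵥ τ.weight) v : ℝ) : ℂ) := by
  have h := hasSum_sum (s := Finset.univ) fun v _ => hasSum_pow_mulVec E hR τ.weight v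
  have h' : partitionTerm E β τ = fun k : ℕ =>
      ((∑ v, Real.exp (-β * k) * ((E.adj ^ k) *ᵥ τ.weight) v : ℝ) : ℂ) := funext fun k => by
    rw [partitionTerm, ← Finset.mul_sum, Complex.ofReal_mul, Complex.ofReal_sum]
    exact congrArg _ (Finset.sum_congr rfl fun v _ => sum_paths_trace E τ v k)
  rw [h']
  exact Complex.hasSum_ofReal.mpr h

end Partition

/-! ### Restrictions in a self-similar action -/

section Elt

variable {V : Type u} [Groupoid.{u} V]

theorem elt_eqToHom_comp {x y z : V} (h : x = y) (g : y ⟶ z) : elt (eqToHom h ≫ g) = elt g := by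
  subst h
  rw [eqToHom_refl, Category.id_comp]

theorem elt_comp_eqToHom {x y z : V} (g : x ⟶ y) (h : y = z) : elt (g ≫ eqToHom h) = elt g := by
  subst h
  rw [eqToHom_refl, Category.comp_id]

end Elt

theorem DirGraph.isPathFrom_of_append {V D : Type u} (E : DirGraph V D) {v : V} {l m : List D}
    (h : E.IsPathFrom v (l ++ m)) : E.IsPathFrom (E.listSource v l) m := by
  induction l generalizing v with
  | nil => exact h
  | cons e l ih => exact ih h.2

theorem DirGraph.Path.source_append {V D : Type u} {E : DirGraph V D} {x : V} (μ : E.Path x)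
    (ν : E.Path μ.source) : (μ.append ν).source = ν.source := by
  obtain ⟨l, hl⟩ := μ
  obtain ⟨m, hm⟩ := ν
  change E.listSource x (l ++ m) = E.listSource (E.listSource x l) m
  clear hm
  induction l generalizing x with
  | nil => rfl
  | cons e l ih => exact ih hl.2

theorem DirGraph.Path.append_injective {V D : Type u} {E : DirGraph V D} {x : V} (μ : E.Path x) :
    Function.Injective (μ.append : E.Path μ.source → E.Path x) := fun _ _ h =>
  Subtype.ext (List.append_cancel_left (congrArg Subtype.val h))

namespace SelfSimilarAction

variable {V D : Type u} [Groupoid.{u} V] {E : DirGraph V D} (S : SelfSimilarAction E)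

theorem length_app {x y : V} (g : x ⟶ y) (μ : E.Path x) : (S.app g μ).1.length = μ.1.length :=
  (S.act g).length_map μ

theorem app_id (x : V) (μ : E.Path x) : S.app (𝟙 x) μ = μ := S.act_id x μ

theorem app_comp {x y z : V} (h : x ⟶ y) (g : y ⟶ z) (μ : E.Path x) :
    S.app (h ≫ g) μ = S.app g (S.app h μ) := S.act_comp h g μ

theorem app_injective {x y : V} (g : x ⟶ y) : Function.Injective (S.app g) :=
  (S.act g).toEquiv.injective

/-- The restriction `g|_μ` in terms of edge lists, which frees the identities for restrictions from
the dependence of their types on sources of paths. -/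
theorem edges_app_restrict {x y : V} (g : x ⟶ y) (μ : E.Path x) (ν : E.Path μ.source) :
    (S.app (S.restrict g μ) ν).1 = (S.app g (μ.append ν)).1.drop μ.1.length := by
  rw [app_append, ← S.length_app g μ]
  exact List.drop_left.symm

/-- Faithfulness for groupoid elements whose domains and termini agree only propositionally. -/
theorem elt_ext {x y x' y' : V} {k : x ⟶ y} {k' : x' ⟶ y'} (hx : x = x') (hy : y = y')
    (h : ∀ (ν : E.Path x) (ν' : E.Path x'), ν.1 = ν'.1 → (S.app k ν).1 = (S.app k' ν').1) :
    elt k = elt k' := by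
  subst hx hy
  have : k = k' := S.faithful _ _ (DirGraph.PartialIso.ext (Equiv.ext fun ν =>
    Subtype.ext (h ν ν rfl)))
  rw [this]

theorem elt_restrict_id {x : V} (μ : E.Path x) : elt (S.restrict (𝟙 x) μ) = elt (𝟙 μ.source) := by
  refine S.elt_ext rfl (by rw [app_id]) fun ν ν' h => ?_
  rw [edges_app_restrict, app_id, app_id, ← h]
  exact List.drop_left

theorem elt_restrict_comp {x y z : V} (h : x ⟶ y) (g : y ⟶ z) (μ : E.Path x) :
    elt (S.restrict (h ≫ g) μ) = elt (S.restrict h μ ≫ S.restrict g (S.app h μ)) := by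
  refine S.elt_ext rfl (by rw [app_comp]) fun ν ν' hν => ?_
  obtain rfl := Subtype.ext hν
  rw [edges_app_restrict, app_comp, app_comp, edges_app_restrict, ← app_append, length_app]

theorem elt_restrict_append {x y : V} (g : x ⟶ y) (μ : E.Path x) (ν : E.Path μ.source) :
    elt (S.restrict g (μ.append ν)) = elt (S.restrict (S.restrict g μ) ν) := by
  refine S.elt_ext (DirGraph.Path.source_append μ ν) ?_ fun κ κ' h => ?_
  · rw [app_append, DirGraph.Path.source_append]
  · rw [edges_app_restrict, edges_app_restrict, edges_app_restrict, List.drop_drop]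
    have h1 : (μ.append ν).append κ = μ.append (ν.append κ') :=
      Subtype.ext ((List.append_assoc _ _ _).trans (by rw [show κ.edges = κ'.edges from h]; rfl))
    rw [h1]
    congr 1
    exact List.length_append

end SelfSimilarAction

/-! ### Hilbert sums -/

section HilbertSum

variable {ι : Type*} {G : ι → Type*} [∀ i, NormedAddCommGroup (G i)]
  [∀ i, InnerProductSpace ℂ (G i)]

open Classical in
/-- The inclusion of a summand in a Hilbert sum. -/
def lpIncl (i : ι) : G i →ₗᵢ[ℂ] lp G 2 where
  toLinearMap := lp.lsingle 2 i
  norm_map' := lp.norm_single (by norm_num) i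

theorem inner_lpIncl_left (i : ι) (a : G i) (f : lp G 2) :
    inner ℂ (lpIncl i a) f = inner ℂ a (f i) := by
  classical
  exact lp.inner_single_left i a f

theorem lpIncl_apply_self (i : ι) (a : G i) : (lpIncl i a : lp G 2) i = a :=
  by classical exact lp.single_apply_self 2 i a

theorem lpIncl_apply_ne {i j : ι} (a : G i) (h : j ≠ i) : (lpIncl i a : lp G 2) j = 0 :=
  by classical exact lp.single_apply_ne 2 i a h

theorem inner_lpIncl_lpIncl_ne {i j : ι} (h : i ≠ j) (a : G i) (b : G j) :
    inner ℂ (lpIncl i a : lp G 2) (lpIncl j b) = 0 := by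
  rw [inner_lpIncl_left, lpIncl_apply_ne b h, inner_zero_right]

theorem ext_lpIncl {F : Type*} [NormedAddCommGroup F] [NormedSpace ℂ F] {f g : lp G 2 →L[ℂ] F}
    (h : ∀ i a, f (lpIncl i a) = g (lpIncl i a)) : f = g := by
  classical
  refine lp.ext_continuousLinearMap (by norm_num) fun i => ContinuousLinearMap.ext fun a => ?_
  exact h i a

theorem eq_zero_of_inner_lpIncl {f : lp G 2} (h : ∀ i a, inner ℂ (lpIncl i a) f = 0) : f = 0 :=
  lp.ext (funext fun i => by
    have h1 := h i (f i)
    rw [inner_lpIncl_left, inner_self_eq_zero] at h1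
    exact h1)

theorem OrthogonalFamily.linearIsometry_lpIncl {F : Type*} [NormedAddCommGroup F]
    [InnerProductSpace ℂ F] [CompleteSpace F] {W : ∀ i, G i →ₗᵢ[ℂ] F}
    (hW : OrthogonalFamily ℂ G W) (i : ι) (a : G i) : hW.linearIsometry (lpIncl i a) = W i a := by
  classical
  exact hW.linearIsometry_apply_single a

variable [∀ i, CompleteSpace (G i)]

theorem adjoint_lpIncl (i : ι) (f : lp G 2) :
    ContinuousLinearMap.adjoint (lpIncl i : G i →ₗᵢ[ℂ] lp G 2).toContinuousLinearMap f = f i := by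
  refine ext_inner_left ℂ fun a => ?_
  rw [ContinuousLinearMap.adjoint_inner_right]
  exact inner_lpIncl_left i a f

/-- The operator on a Hilbert sum given by a single matrix entry. -/
def lpEntry {i j : ι} (X : G i →L[ℂ] G j) : lp G 2 →L[ℂ] lp G 2 :=
  (lpIncl j).toContinuousLinearMap ∘L X ∘L
    ContinuousLinearMap.adjoint (lpIncl i).toContinuousLinearMap

theorem lpEntry_apply {i j : ι} (X : G i →L[ℂ] G j) (f : lp G 2) :
    lpEntry X f = lpIncl j (X (f i)) := by
  rw [lpEntry, ContinuousLinearMap.comp_apply, ContinuousLinearMap.comp_apply, adjoint_lpIncl]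
  rfl

theorem lpEntry_mul {i j k : ι} (X : G j →L[ℂ] G k) (Y : G i →L[ℂ] G j) :
    lpEntry X * lpEntry Y = lpEntry (X ∘L Y) := by
  ext1 f
  rw [mul_apply_eq_comp, lpEntry_apply, lpEntry_apply, lpIncl_apply_self,
    lpEntry_apply]
  rfl

theorem lpEntry_mul_of_ne {i j j' k : ι} (X : G j' →L[ℂ] G k) (Y : G i →L[ℂ] G j) (h : j' ≠ j) :
    lpEntry X * lpEntry Y = 0 := by
  ext1 f
  rw [mul_apply_eq_comp, lpEntry_apply, lpEntry_apply, lpIncl_apply_ne _ h,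
    map_zero, map_zero]
  rfl

theorem star_lpEntry {i j : ι} (X : G i →L[ℂ] G j) :
    star (lpEntry X) = lpEntry (ContinuousLinearMap.adjoint X) := by
  rw [ContinuousLinearMap.star_eq_adjoint, lpEntry, ContinuousLinearMap.adjoint_comp,
    ContinuousLinearMap.adjoint_comp, ContinuousLinearMap.adjoint_adjoint]
  rfl

theorem sum_lpEntry_id [Fintype ι] : ∑ i, lpEntry (ContinuousLinearMap.id ℂ (G i)) = 1 := by
  refine ext_lpIncl fun i a => ?_
  rw [sum_apply, Finset.sum_eq_single i]
  · rw [lpEntry_apply, lpIncl_apply_self]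
    rfl
  · intro j _ hj
    rw [lpEntry_apply, lpIncl_apply_ne a hj, map_zero, map_zero]
  · exact fun h => absurd (Finset.mem_univ i) h

end HilbertSum

/-! ### Unitary representations of groupoids and the GNS representation of a trace -/

/-- A unitary representation of a groupoid on a bundle of Hilbert spaces over its unit space. The
maps `W g` are isometries, and invertible by functoriality. -/
structure GroupoidHilbertRep (V : Type u) [Groupoid.{u} V] where
  H : V → Type u
  [normed (x : V) : NormedAddCommGroup (H x)]
  [innerProduct (x : V) : InnerProductSpace ℂ (H x)]
  [complete (x : V) : CompleteSpace (H x)]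
  W {x y : V} (g : x ⟶ y) : H x →ₗᵢ[ℂ] H y
  W_id (x : V) (a : H x) : W (𝟙 x) a = a
  W_comp {x y z : V} (h : x ⟶ y) (g : y ⟶ z) (a : H x) : W (h ≫ g) a = W g (W h a)

namespace GroupoidHilbertRep

attribute [instance] normed innerProduct complete

/-- Every trace on `C⋆(𝒢)` is given by a section `η` of a unitary representation. The Hilbert space
over `x` is the range of the projection `u_x` in the GNS representation. -/
theorem exists_of_trace {V : Type u} [Groupoid.{u} V] [Fintype V]
    (τ : CStarTrace (GroupoidCStar V)) :
    ∃ (ρ : GroupoidHilbertRep V) (η : ∀ x, ρ.H x),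
      ∀ {x : V} (g : x ⟶ x), inner ℂ (η x) (ρ.W g (η x)) = τ (GroupoidCStar.u g) := by
  let _ : PartialOrder (GroupoidCStar V) := CStarAlgebra.spectralOrder _
  have : StarOrderedRing (GroupoidCStar V) := CStarAlgebra.spectralOrderedRing _
  let f := τ.toCStarState.toPositiveLinearMap
  let π : GroupoidCStar V →⋆ₐ[ℂ] (f.GNS →L[ℂ] f.GNS) := f.gnsStarAlgHom
  have hmul : ∀ {x y z : V} (g : y ⟶ z) (h : x ⟶ y) (a : f.GNS),
      π (GroupoidCStar.u g) (π (GroupoidCStar.u h) a) = π (GroupoidCStar.u (h ≫ g)) a := by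
    intro x y z g h a
    rw [← GroupoidCStar.u_mul_u, map_mul]
    rfl
  have hinner : ∀ (b c : GroupoidCStar V) (a a' : f.GNS),
      inner ℂ (π b a) (π c a') = inner ℂ a (π (star b * c) a') := by
    intro b c a a'
    rw [map_mul, map_star, mul_apply_eq_comp, ContinuousLinearMap.star_eq_adjoint,
      ContinuousLinearMap.adjoint_inner_right]
  let H : V → Submodule ℂ f.GNS := fun x =>
    LinearMap.ker ((π (GroupoidCStar.u (𝟙 x)) - 1 : f.GNS →L[ℂ] f.GNS) : f.GNS →ₗ[ℂ] f.GNS)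
  have hH : ∀ (x : V) (a : f.GNS), a ∈ H x ↔ π (GroupoidCStar.u (𝟙 x)) a = a := by
    intro x a
    rw [LinearMap.mem_ker]
    exact sub_eq_zero
  have hcomplete : ∀ x, CompleteSpace (H x) := fun x =>
    (ContinuousLinearMap.isClosed_ker (π (GroupoidCStar.u (𝟙 x)) - 1)).completeSpace_coe
  let W : ∀ {x y : V}, (x ⟶ y) → (H x →ₗᵢ[ℂ] H y) := fun {x y} g =>
    { toLinearMap := LinearMap.restrict (π (GroupoidCStar.u g) : f.GNS →ₗ[ℂ] f.GNS)
        fun a _ => (hH y _).mpr (by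
          change π _ (π _ a) = π _ a
          rw [hmul, Category.comp_id])
      norm_map' := fun a => by
        change ‖π (GroupoidCStar.u g) (a : f.GNS)‖ = ‖(a : f.GNS)‖
        rw [← sq_eq_sq₀ (norm_nonneg _) (norm_nonneg _), ← Complex.ofReal_inj,
          Complex.ofReal_pow, Complex.ofReal_pow]
        have h1 := inner_self_eq_norm_sq_to_K (𝕜 := ℂ) (π (GroupoidCStar.u g) (a : f.GNS))
        have h2 := inner_self_eq_norm_sq_to_K (𝕜 := ℂ) (a : f.GNS)
        rw [hinner, GroupoidCStar.star_u_mul_u, (hH x _).mp a.2, h2] at h1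
        exact h1.symm }
  let ξ : f.GNS := ((f.toPreGNS 1 : f.PreGNS) : f.GNS)
  have hξ : ∀ b, inner ℂ ξ (π b ξ) = τ b := by
    intro b
    have h1 : π b ξ = ((f.toPreGNS b : f.PreGNS) : f.GNS) := by
      change f.gnsNonUnitalStarAlgHom b ((f.toPreGNS 1 : f.PreGNS) : f.GNS) = _
      rw [f.gnsNonUnitalStarAlgHom_apply_coe, f.leftMulMapPreGNS_apply]
      simp
    rw [h1, UniformSpace.Completion.inner_coe, f.preGNS_inner_def]
    simp only [PositiveLinearMap.ofPreGNS_toPreGNS, star_one, one_mul]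
    rfl
  refine ⟨{ H := fun x => H x, W := W, W_id := ?_, W_comp := ?_ }, fun x =>
    ⟨π (GroupoidCStar.u (𝟙 x)) ξ, (hH x _).mpr ?_⟩, ?_⟩
  · exact fun x a => Subtype.ext ((hH x _).mp a.2)
  · exact fun h g a => Subtype.ext (hmul g h a).symm
  · rw [hmul, Category.comp_id]
  · intro x g
    change inner ℂ (π (GroupoidCStar.u (𝟙 x)) ξ)
      (π (GroupoidCStar.u g) (π (GroupoidCStar.u (𝟙 x)) ξ)) = _
    rw [hmul, Category.id_comp, hinner, hξ]
    congr 1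
    rw [GroupoidCStar.u, ← (GroupoidCStar.isGroupoidRep V).inv, Groupoid.inv_eq_inv, IsIso.inv_id]
    exact (GroupoidCStar.u_mul_u _ _).trans (by rw [Category.comp_id])

/-! ### The Fock representation -/

variable {V D : Type u} [Groupoid.{u} V] {E : DirGraph V D} (ρ : GroupoidHilbertRep V)

/-- The Hilbert sum of the spaces `H_{s(μ)}` over the paths `μ` with range `v`. -/
abbrev Fock (E : DirGraph V D) (v : V) : Type u := lp (fun μ : E.Path v => ρ.H μ.source) 2

/-- `a ∈ H_{s(μ)}` as a vector in the Fock space. -/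
abbrev ket {v : V} (μ : E.Path v) : ρ.H μ.source →ₗᵢ[ℂ] ρ.Fock E v :=
  lpIncl (G := fun μ : E.Path v => ρ.H μ.source) μ

/-- The vectors `δ_μ ⊗ W(g) a` depend only on `μ` and on the groupoid element `g`, whose type may
change along with `μ`. -/
theorem ket_congr {v x x' : V} {μ ν : E.Path v} (hμν : μ = ν) {g : x ⟶ μ.source}
    {k : x' ⟶ ν.source} (hgk : elt g = elt k) (a : ρ.H x) (a' : ρ.H x') (ha : a ≍ a') :
    ρ.ket μ (ρ.W g a) = ρ.ket ν (ρ.W k a') := by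
  subst hμν
  obtain rfl : x = x' := congrArg Sigma.fst hgk
  obtain rfl := eq_of_heq ha
  obtain rfl : g = k := by simpa using hgk
  rfl

section Unitary

variable (S : SelfSimilarAction E)

theorem orthogonalFamily_act {x y : V} (g : x ⟶ y) :
    OrthogonalFamily ℂ (fun μ : E.Path x => ρ.H μ.source)
      fun μ => (ρ.ket (S.app g μ)).comp (ρ.W (S.restrict g μ)) :=
  fun _ _ hne _ _ => inner_lpIncl_lpIncl_ne ((S.app_injective g).ne hne) _ _

/-- The action of a groupoid element `g` on the Fock spaces, `δ_μ ⊗ a ↦ δ_{g·μ} ⊗ W(g|_μ) a`. -/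
def fockU {x y : V} (g : x ⟶ y) : ρ.Fock E x →ₗᵢ[ℂ] ρ.Fock E y :=
  (ρ.orthogonalFamily_act S g).linearIsometry

theorem fockU_ket {x y : V} (g : x ⟶ y) (μ : E.Path x) (a : ρ.H μ.source) :
    ρ.fockU S g (ρ.ket μ a) = ρ.ket (S.app g μ) (ρ.W (S.restrict g μ) a) :=
  OrthogonalFamily.linearIsometry_lpIncl (ρ.orthogonalFamily_act S g) μ a

theorem fockU_id (x : V) :
    (ρ.fockU S (𝟙 x)).toContinuousLinearMap = ContinuousLinearMap.id ℂ (ρ.Fock E x) :=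
  ext_lpIncl fun μ a => by
    change ρ.fockU S (𝟙 x) (ρ.ket μ a) = ρ.ket μ a
    rw [fockU_ket, ρ.ket_congr (S.app_id x μ) (S.elt_restrict_id μ) a a HEq.rfl, W_id]

theorem fockU_comp {x y z : V} (h : x ⟶ y) (g : y ⟶ z) :
    (ρ.fockU S g).toContinuousLinearMap ∘L (ρ.fockU S h).toContinuousLinearMap =
      (ρ.fockU S (h ≫ g)).toContinuousLinearMap :=
  ext_lpIncl fun μ a => by
    change ρ.fockU S g (ρ.fockU S h (ρ.ket μ a)) = ρ.fockU S (h ≫ g) (ρ.ket μ a)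
    rw [fockU_ket, fockU_ket, fockU_ket, ← W_comp]
    exact (ρ.ket_congr (S.app_comp h g μ) (S.elt_restrict_comp h g μ) a a HEq.rfl).symm

end Unitary

theorem orthogonalFamily_append {x : V} (μ : E.Path x) :
    OrthogonalFamily ℂ (fun ν : E.Path μ.source => ρ.H ν.source)
      fun ν => (ρ.ket (μ.append ν)).comp
        (ρ.W (eqToHom (DirGraph.Path.source_append μ ν).symm)) :=
  fun _ _ hne _ _ => inner_lpIncl_lpIncl_ne ((DirGraph.Path.append_injective μ).ne hne) _ _

/-- The creation operator `δ_ν ⊗ a ↦ δ_{μν} ⊗ a` of a path `μ`. -/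
def fockS {x : V} (μ : E.Path x) : ρ.Fock E μ.source →ₗᵢ[ℂ] ρ.Fock E x :=
  (ρ.orthogonalFamily_append μ).linearIsometry

theorem fockS_ket {x : V} (μ : E.Path x) (ν : E.Path μ.source) (a : ρ.H ν.source) :
    ρ.fockS μ (ρ.ket ν a) =
      ρ.ket (μ.append ν) (ρ.W (eqToHom (DirGraph.Path.source_append μ ν).symm) a) :=
  OrthogonalFamily.linearIsometry_lpIncl (ρ.orthogonalFamily_append μ) ν a

theorem fockU_comp_fockS (S : SelfSimilarAction E) {x y : V} (g : x ⟶ y) (μ : E.Path x) :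
    (ρ.fockU S g).toContinuousLinearMap ∘L (ρ.fockS μ).toContinuousLinearMap =
      (ρ.fockS (S.app g μ)).toContinuousLinearMap ∘L
        (ρ.fockU S (S.restrict g μ)).toContinuousLinearMap :=
  ext_lpIncl fun ν a => by
    change ρ.fockU S g (ρ.fockS μ (ρ.ket ν a)) =
      ρ.fockS (S.app g μ) (ρ.fockU S (S.restrict g μ) (ρ.ket ν a))
    rw [fockS_ket, fockU_ket, fockU_ket, fockS_ket, ← W_comp, ← W_comp]
    refine ρ.ket_congr (S.app_append g μ ν) ?_ a a HEq.rfl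
    rw [elt_eqToHom_comp, elt_comp_eqToHom, S.elt_restrict_append]

theorem adjoint_fockS_ket_of_ne {x : V} (μ ν : E.Path x) (h : ∀ κ, ν ≠ μ.append κ)
    (a : ρ.H ν.source) :
    ContinuousLinearMap.adjoint (ρ.fockS μ).toContinuousLinearMap (ρ.ket ν a) = 0 :=
  eq_zero_of_inner_lpIncl fun κ b => by
    rw [ContinuousLinearMap.adjoint_inner_right]
    change inner ℂ (ρ.fockS μ (ρ.ket κ b)) (ρ.ket ν a) = 0
    rw [fockS_ket]
    exact inner_lpIncl_lpIncl_ne (h κ).symm _ _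

theorem adjoint_comp_fockS {x : V} (μ : E.Path x) :
    ContinuousLinearMap.adjoint (ρ.fockS μ).toContinuousLinearMap ∘L
      (ρ.fockS μ).toContinuousLinearMap = ContinuousLinearMap.id ℂ _ :=
  (ContinuousLinearMap.norm_map_iff_adjoint_comp_self _).mp (ρ.fockS μ).norm_map

theorem adjoint_comp_fockS_of_disjoint {x : V} (μ ν : E.Path x)
    (h : ∀ κ κ', ν.append κ ≠ μ.append κ') :
    ContinuousLinearMap.adjoint (ρ.fockS μ).toContinuousLinearMap ∘L
      (ρ.fockS ν).toContinuousLinearMap = 0 :=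
  ext_lpIncl fun κ a => by
    change ContinuousLinearMap.adjoint (ρ.fockS μ).toContinuousLinearMap
      (ρ.fockS ν (ρ.ket κ a)) = 0
    rw [fockS_ket]
    exact ρ.adjoint_fockS_ket_of_ne μ _ (h κ) _

/-- The Hilbert space of the Fock representation, the sum of the Fock spaces over all vertices. -/
abbrev FockTotal (E : DirGraph V D) : Type u := lp (fun v : V => ρ.Fock E v) 2

variable (S : SelfSimilarAction E)

/-- The operators of the groupoid in the Fock representation. -/
def repU (g : GroupoidElt V) : ρ.FockTotal E →L[ℂ] ρ.FockTotal E :=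
  lpEntry (ρ.fockU S g.2.2).toContinuousLinearMap

/-- The creation operators of the edges in the Fock representation. -/
def repT (E : DirGraph V D) (e : D) : ρ.FockTotal E →L[ℂ] ρ.FockTotal E :=
  lpEntry (ρ.fockS (DirGraph.edgePath e (rfl : E.r e = E.r e))).toContinuousLinearMap

theorem repT_eq (e : D) {x : V} (he : E.r e = x) :
    ρ.repT E e = lpEntry (ρ.fockS (DirGraph.edgePath e he)).toContinuousLinearMap := by
  subst he
  rfl

theorem isGroupoidRep_repU [Fintype V] : IsGroupoidRep (ρ.repU S) where
  mul g h := by rw [repU, repU, lpEntry_mul, fockU_comp, repU]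
  mul_of_ne g h hne := lpEntry_mul_of_ne _ _ hne
  inv {x y} g := by
    rw [repU, repU, star_lpEntry]
    congr 1
    have h1 : ContinuousLinearMap.adjoint (ρ.fockU S g).toContinuousLinearMap ∘L
        (ρ.fockU S g).toContinuousLinearMap = ContinuousLinearMap.id ℂ _ :=
      (ContinuousLinearMap.norm_map_iff_adjoint_comp_self _).mp (ρ.fockU S g).norm_map
    have h2 := ρ.fockU_comp S (Groupoid.inv g) g
    rw [Groupoid.inv_comp, fockU_id] at h2
    calc _ = (ContinuousLinearMap.adjoint (ρ.fockU S g).toContinuousLinearMap ∘L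
        (ρ.fockU S g).toContinuousLinearMap) ∘L
          (ρ.fockU S (Groupoid.inv g)).toContinuousLinearMap := by
          rw [h1, ContinuousLinearMap.id_comp]
      _ = _ := by rw [ContinuousLinearMap.comp_assoc, h2, ContinuousLinearMap.comp_id]
  sum_unit := by
    simp only [repU, fockU_id]
    exact sum_lpEntry_id

/-- In the Fock representation, a path of length one acts as its creation operator. -/
theorem pathElt_edge [Fintype V] {y : V} (μ : E.Path y) (hμ : μ.1.length = 1) :
    pathElt (ρ.repU S) (ρ.repT E) μ = lpEntry (ρ.fockS μ).toContinuousLinearMap := by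
  obtain ⟨_ | ⟨e, _ | ⟨e', l⟩⟩, hl⟩ := μ
  · simp at hμ
  · obtain ⟨rfl, -⟩ := hl
    change ρ.repU S (elt (𝟙 (E.r e))) * (ρ.repT E e * 1) = _
    rw [mul_one, repU, repT, lpEntry_mul, fockU_id, ContinuousLinearMap.id_comp]
    rfl
  · simp at hμ

/-- The groupoid and the creation operators of the edges form a Toeplitz representation; the
covariance relation expresses `g · (eν) = (g · e)(g|_e · ν)` and `g|_{eν} = (g|_e)|_ν`. -/
theorem isToeplitzRep [Fintype V] : IsToeplitzRep S (ρ.repU S) (ρ.repT E) where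
  toIsGroupoidRep := ρ.isGroupoidRep_repU S
  star_mul_self e := by
    rw [repT, star_lpEntry, lpEntry_mul, adjoint_comp_fockS, repU, fockU_id]
    rfl
  star_mul_of_ne {e f} hne := by
    by_cases h : E.r f = E.r e
    · rw [ρ.repT_eq f h, repT, star_lpEntry, lpEntry_mul, adjoint_comp_fockS_of_disjoint]
      · ext1 a
        rw [lpEntry_apply, zero_apply, map_zero]
        rfl
      · exact fun κ κ' h' => hne (List.cons.inj (congrArg Subtype.val h')).1.symm
    · rw [repT, repT, star_lpEntry]
      exact lpEntry_mul_of_ne _ _ (Ne.symm h)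
  range_mul e := by
    rw [repT, repU, lpEntry_mul, fockU_id, ContinuousLinearMap.id_comp]
  covariance {x y} g e he := by
    subst he
    rw [ρ.pathElt_edge S _ (S.length_app g _), repU, repT, lpEntry_mul, fockU_comp_fockS]
    rw [repU, lpEntry_mul]
  mul_of_range_ne g e he := lpEntry_mul_of_ne _ _ (Ne.symm he)

end GroupoidHilbertRep

namespace GroupoidHilbertRep

/-! ### Vector states of the Fock representation -/

variable {V D : Type u} [Groupoid.{u} V] {E : DirGraph V D} (ρ : GroupoidHilbertRep V)

/-- The vector `δ_μ ⊗ η_{s(μ)}` of the Fock representation. -/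
def vec (η : ∀ x, ρ.H x) {v : V} (μ : E.Path v) : ρ.FockTotal E :=
  lpIncl (G := fun v : V => ρ.Fock E v) v (ρ.ket μ (η μ.source))

variable (S : SelfSimilarAction E) (η : ∀ x, ρ.H x)

theorem repU_vec {x y : V} (g : x ⟶ y) (μ : E.Path x) :
    ρ.repU S (elt g) (ρ.vec η μ) = lpIncl (G := fun v : V => ρ.Fock E v) y
      (ρ.ket (S.app g μ) (ρ.W (S.restrict g μ) (η μ.source))) := by
  rw [repU, lpEntry_apply, vec, lpIncl_apply_self]
  exact congrArg _ (ρ.fockU_ket S g μ _)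

theorem repU_vec_of_ne {x y v : V} (g : x ⟶ y) (μ : E.Path v) (h : x ≠ v) :
    ρ.repU S (elt g) (ρ.vec η μ) = 0 := by
  rw [repU, lpEntry_apply, vec, lpIncl_apply_ne _ h, map_zero, map_zero]

theorem repU_id_vec {x : V} (μ : E.Path x) : ρ.repU S (elt (𝟙 x)) (ρ.vec η μ) = ρ.vec η μ := by
  rw [repU, lpEntry_apply, fockU_id, vec, lpIncl_apply_self]
  rfl

theorem inner_vec_repU_vec_of_ne {x y : V} (g : x ⟶ y) (μ : E.Path x) (ν : E.Path y)
    (h : S.app g μ ≠ ν) : inner ℂ (ρ.vec η ν) (ρ.repU S (elt g) (ρ.vec η μ)) = 0 := by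
  rw [repU_vec, vec, inner_lpIncl_left, lpIncl_apply_self]
  exact inner_lpIncl_lpIncl_ne h.symm _ _

theorem inner_vec_repU_vec_self [Fintype V] {τ : CStarTrace (GroupoidCStar V)}
    (hη : ∀ {x : V} (g : x ⟶ x), inner ℂ (η x) (ρ.W g (η x)) = τ (GroupoidCStar.u g))
    {x : V} (g : x ⟶ x) (μ : E.Path x) (h : S.app g μ = μ) :
    inner ℂ (ρ.vec η μ) (ρ.repU S (elt g) (ρ.vec η μ)) =
      τ (GroupoidCStar.u (S.restrict g μ)) := by
  rw [repU_vec, vec, inner_lpIncl_left, lpIncl_apply_self]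
  have key : ∀ (ν : E.Path x) (k : μ.source ⟶ ν.source), ν = μ →
      inner ℂ (ρ.ket μ (η μ.source)) (ρ.ket ν (ρ.W k (η μ.source))) = τ (GroupoidCStar.u k) := by
    rintro ν k rfl
    rw [LinearIsometry.inner_map_map]
    exact hη k
  exact key _ _ h

theorem inner_vec_self [Fintype V] {τ : CStarTrace (GroupoidCStar V)}
    (hη : ∀ {x : V} (g : x ⟶ x), inner ℂ (η x) (ρ.W g (η x)) = τ (GroupoidCStar.u g))
    {x : V} (μ : E.Path x) :
    inner ℂ (ρ.vec η μ) (ρ.vec η μ) = τ (GroupoidCStar.u (𝟙 μ.source)) := by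
  rw [vec, LinearIsometry.inner_map_map, LinearIsometry.inner_map_map, ← hη, W_id]

theorem norm_sq_vec [Fintype V] {τ : CStarTrace (GroupoidCStar V)}
    (hη : ∀ {x : V} (g : x ⟶ x), inner ℂ (η x) (ρ.W g (η x)) = τ (GroupoidCStar.u g))
    {x : V} (μ : E.Path x) : ‖ρ.vec η μ‖ ^ 2 = τ.weight μ.source := by
  rw [← Complex.ofReal_inj, ← τ.apply_u_id, ← ρ.inner_vec_self η hη μ, Complex.ofReal_pow]
  exact (inner_self_eq_norm_sq_to_K (𝕜 := ℂ) (ρ.vec η μ)).symm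

theorem star_repT_vec_cons {v : V} (e : D) (l : List D) (h : E.IsPathFrom v (e :: l)) :
    star (ρ.repT E e) (ρ.vec η (⟨e :: l, h⟩ : E.Path v)) =
      ρ.vec η (⟨l, h.2⟩ : E.Path (E.s e)) := by
  obtain ⟨rfl, hl⟩ := h
  rw [repT, star_lpEntry, lpEntry_apply, vec, lpIncl_apply_self]
  refine congrArg (lpIncl (G := fun v : V => ρ.Fock E v) (E.s e)) ?_
  have h1 : ρ.fockS (DirGraph.edgePath e (rfl : E.r e = E.r e))
      (ρ.ket (⟨l, hl⟩ : E.Path (E.s e)) (η _)) =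
      ρ.ket (⟨e :: l, rfl, hl⟩ : E.Path (E.r e)) (η _) :=
    (ρ.fockS_ket _ _ _).trans (congrArg (ρ.ket _) (ρ.W_id _ _))
  rw [← h1]
  exact congrFun (congrArg DFunLike.coe (ρ.adjoint_comp_fockS (DirGraph.edgePath e rfl))) _

theorem star_repT_vec_of_ne {v : V} (e : D) (μ : E.Path v) (h : ∀ l, μ.1 ≠ e :: l) :
    star (ρ.repT E e) (ρ.vec η μ) = 0 := by
  by_cases hv : E.r e = v
  · subst hv
    rw [repT, star_lpEntry, lpEntry_apply, vec, lpIncl_apply_self]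
    rw [ρ.adjoint_fockS_ket_of_ne, map_zero]
    exact fun κ hκ => h κ.1 (congrArg Subtype.val hκ)
  · rw [repT, star_lpEntry, lpEntry_apply, vec, lpIncl_apply_ne _ hv, map_zero, map_zero]

theorem star_prod_repT_vec_append (l m : List D) {v : V} (h : E.IsPathFrom v (l ++ m))
    (h' : E.IsPathFrom (E.listSource v l) m) :
    star (l.map (ρ.repT E)).prod (ρ.vec η (⟨l ++ m, h⟩ : E.Path v)) =
      ρ.vec η (⟨m, h'⟩ : E.Path (E.listSource v l)) := by
  induction l generalizing v with
  | nil =>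
    rw [List.map_nil, List.prod_nil, star_one]
    rfl
  | cons e l ih =>
    rw [List.map_cons, List.prod_cons, star_mul, mul_apply_eq_comp]
    exact (congrArg _ (ρ.star_repT_vec_cons η e (l ++ m) h)).trans (ih h.2 h')

theorem star_prod_repT_vec_of_ne (l : List D) {v : V} (μ : E.Path v) (h : ∀ m, μ.1 ≠ l ++ m) :
    star (l.map (ρ.repT E)).prod (ρ.vec η μ) = 0 := by
  induction l generalizing v with
  | nil => exact absurd rfl (h μ.1)
  | cons e l ih =>
    rw [List.map_cons, List.prod_cons, star_mul, mul_apply_eq_comp]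
    by_cases hμ : ∀ m, μ.1 ≠ e :: m
    · rw [star_repT_vec_of_ne ρ η e μ hμ, map_zero]
    · push Not at hμ
      obtain ⟨m, hm⟩ := hμ
      obtain ⟨_, hp⟩ := μ
      obtain rfl : _ = e :: m := hm
      rw [star_repT_vec_cons]
      exact ih _ fun m' hm' => h m' (congrArg (e :: ·) hm')

variable [Fintype V]

theorem star_pathElt_vec_append {x : V} (μ : E.Path x) (κ : E.Path μ.source) :
    star (pathElt (ρ.repU S) (ρ.repT E) μ) (ρ.vec η (μ.append κ)) = ρ.vec η κ := by
  rw [pathElt, star_mul, mul_apply_eq_comp, ← (ρ.isGroupoidRep_repU S).inv,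
    Groupoid.inv_eq_inv, IsIso.inv_id, repU_id_vec]
  exact ρ.star_prod_repT_vec_append η μ.1 κ.1 _ κ.2

theorem star_pathElt_vec_of_ne {x v : V} (μ : E.Path x) (ν : E.Path v)
    (h : ∀ κ, (⟨v, ν⟩ : Σ v, E.Path v) ≠ ⟨x, μ.append κ⟩) :
    star (pathElt (ρ.repU S) (ρ.repT E) μ) (ρ.vec η ν) = 0 := by
  rw [pathElt, star_mul, mul_apply_eq_comp, ← (ρ.isGroupoidRep_repU S).inv,
    Groupoid.inv_eq_inv, IsIso.inv_id]
  by_cases hv : x = v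
  · subst hv
    rw [repU_id_vec]
    refine ρ.star_prod_repT_vec_of_ne η μ.1 ν fun m hm => ?_
    have hm' : E.IsPathFrom μ.source m := E.isPathFrom_of_append (hm ▸ ν.2)
    exact h ⟨m, hm'⟩ (by rw [show ν = μ.append ⟨m, hm'⟩ from Subtype.ext hm])
  · rw [repU_vec_of_ne ρ S η _ ν hv, map_zero]

/-- The Fock representation of the Toeplitz algebra. -/
def fockRep : ToeplitzCStar S →⋆ₐ[ℂ] (ρ.FockTotal E →L[ℂ] ρ.FockTotal E) :=
  UniversalCStar.lift (R := toeplitzRelations S) (Sum.elim (ρ.repU S) (ρ.repT E))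
    (ρ.isToeplitzRep S)

theorem fockRep_u {x y : V} (g : x ⟶ y) :
    ρ.fockRep S (ToeplitzCStar.u S g) = ρ.repU S (elt g) :=
  UniversalCStar.lift_gen _ _ _

theorem fockRep_s {x : V} (μ : E.Path x) :
    ρ.fockRep S (ToeplitzCStar.s S μ) = pathElt (ρ.repU S) (ρ.repT E) μ := by
  rw [ToeplitzCStar.s, pathElt, pathElt, map_mul, map_list_prod, List.map_map]
  congr 1
  · exact UniversalCStar.lift_gen _ _ _
  · congr 2
    exact funext fun e => UniversalCStar.lift_gen _ _ _

theorem inner_fockRep {x y v : V} (μ : E.Path x) (ν : E.Path y) (g : ν.source ⟶ μ.source)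
    (κ : E.Path v) :
    inner ℂ (ρ.vec η κ) (ρ.fockRep S (ToeplitzCStar.s S μ * ToeplitzCStar.u S g *
      star (ToeplitzCStar.s S ν)) (ρ.vec η κ)) =
    inner ℂ (star (pathElt (ρ.repU S) (ρ.repT E) μ) (ρ.vec η κ))
      (ρ.repU S (elt g) (star (pathElt (ρ.repU S) (ρ.repT E) ν) (ρ.vec η κ))) := by
  rw [map_mul, map_mul, map_star, fockRep_s, fockRep_s, fockRep_u, mul_apply_eq_comp,
    mul_apply_eq_comp, ContinuousLinearMap.star_eq_adjoint (pathElt _ _ μ),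
    ContinuousLinearMap.adjoint_inner_left]

theorem inner_fockRep_self_append {x : V} (μ : E.Path x) (g : μ.source ⟶ μ.source)
    (κ : E.Path μ.source) :
    inner ℂ (ρ.vec η (μ.append κ)) (ρ.fockRep S (ToeplitzCStar.s S μ * ToeplitzCStar.u S g *
      star (ToeplitzCStar.s S μ)) (ρ.vec η (μ.append κ))) =
    inner ℂ (ρ.vec η κ) (ρ.repU S (elt g) (ρ.vec η κ)) := by
  rw [inner_fockRep, star_pathElt_vec_append]

theorem inner_fockRep_self_of_ne {x v : V} (μ : E.Path x) (g : μ.source ⟶ μ.source)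
    (κ : E.Path v) (h : ∀ ν, (⟨v, κ⟩ : Σ v, E.Path v) ≠ ⟨x, μ.append ν⟩) :
    inner ℂ (ρ.vec η κ) (ρ.fockRep S (ToeplitzCStar.s S μ * ToeplitzCStar.u S g *
      star (ToeplitzCStar.s S μ)) (ρ.vec η κ)) = 0 := by
  rw [inner_fockRep, star_pathElt_vec_of_ne ρ S η μ κ h, inner_zero_left]

/-- The vector states of the Fock representation vanish at `s_μ u_g s_ν⋆` for `μ ≠ ν`: at a path
`κ = μμ' = νν'` the value is nonzero only if `g · ν' = μ'`, and then `|μ| = |ν|`. -/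
theorem inner_fockRep_of_ne {x y v : V} (μ : E.Path x) (ν : E.Path y) (g : ν.source ⟶ μ.source)
    (hne : (⟨x, μ⟩ : Σ v, E.Path v) ≠ ⟨y, ν⟩) (κ : E.Path v) :
    inner ℂ (ρ.vec η κ) (ρ.fockRep S (ToeplitzCStar.s S μ * ToeplitzCStar.u S g *
      star (ToeplitzCStar.s S ν)) (ρ.vec η κ)) = 0 := by
  rw [inner_fockRep]
  by_cases hμ : ∀ μ', (⟨v, κ⟩ : Σ v, E.Path v) ≠ ⟨x, μ.append μ'⟩
  · rw [ρ.star_pathElt_vec_of_ne S η μ κ hμ, inner_zero_left]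
  by_cases hν : ∀ ν', (⟨v, κ⟩ : Σ v, E.Path v) ≠ ⟨y, ν.append ν'⟩
  · rw [ρ.star_pathElt_vec_of_ne S η ν κ hν, map_zero, inner_zero_right]
  push Not at hμ hν
  obtain ⟨μ', hμ'⟩ := hμ
  obtain ⟨ν', hν'⟩ := hν
  obtain rfl : v = x := congrArg Sigma.fst hμ'
  obtain rfl : v = y := congrArg Sigma.fst hν'
  obtain rfl : κ = μ.append μ' := by simpa using hμ'
  have hκ : μ.append μ' = ν.append ν' := by simpa using hν'
  rw [ρ.star_pathElt_vec_append S η μ μ', hκ, ρ.star_pathElt_vec_append S η ν ν']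
  refine ρ.inner_vec_repU_vec_of_ne S η g ν' μ' fun hg => hne ?_
  -- If `g · ν' = μ'`, then `μ` and `ν` are beginnings of one path of the same length.
  have hlen : μ'.1.length = ν'.1.length := by rw [← hg, S.length_app]
  have h1 : μ.1 ++ μ'.1 = ν.1 ++ ν'.1 := congrArg Subtype.val hκ
  have h2 : μ = ν := Subtype.ext (List.append_inj_left' h1 hlen)
  rw [h2]

end GroupoidHilbertRep

/-! ### The state `Ψ_{β,τ}` -/

namespace GroupoidHilbertRep

variable {V D : Type u} [Groupoid.{u} V] [Fintype V] [Finite D] {E : DirGraph V D}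
  (ρ : GroupoidHilbertRep V) (S : SelfSimilarAction E) (η : ∀ x, ρ.H x) (β : ℝ)

/-- The contribution of the paths of length `k` to the (unnormalised) state, a weighted sum of
vector states of the Fock representation. -/
def stateTerm (k : ℕ) : ToeplitzCStar S →ₗ[ℂ] ℂ where
  toFun a := (Real.exp (-β * k) : ℂ) *
    ∑ v : V, ∑ μ ∈ E.paths v k, inner ℂ (ρ.vec η μ) (ρ.fockRep S a (ρ.vec η μ))
  map_add' a b := by
    simp only [map_add, add_apply, inner_add_right, Finset.sum_add_distrib, mul_add]
  map_smul' c a := by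
    simp only [map_smul, smul_apply, inner_smul_right, ← Finset.mul_sum, RingHom.id_apply,
      smul_eq_mul]
    exact mul_left_comm _ _ _

theorem stateTerm_nonneg (k : ℕ) (a : ToeplitzCStar S) :
    0 ≤ ρ.stateTerm S η β k (star a * a) := by
  refine mul_nonneg (Complex.zero_le_real.mpr (Real.exp_pos _).le)
    (Finset.sum_nonneg fun v _ => Finset.sum_nonneg fun μ _ => ?_)
  rw [map_mul, map_star, mul_apply_eq_comp, ContinuousLinearMap.star_eq_adjoint,
    ContinuousLinearMap.adjoint_inner_right, inner_self_eq_norm_sq_to_K]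
  refine (Complex.zero_le_real.mpr (sq_nonneg ‖ρ.fockRep S a (ρ.vec η μ)‖)).trans_eq ?_
  exact Complex.ofReal_pow _ _

theorem stateTerm_self_of_lt {x : V} (μ : E.Path x) (g : μ.source ⟶ μ.source) {k : ℕ}
    (hk : k < μ.length) :
    ρ.stateTerm S η β k (ToeplitzCStar.s S μ * ToeplitzCStar.u S g *
      star (ToeplitzCStar.s S μ)) = 0 := by
  refine mul_eq_zero_of_right _ (Finset.sum_eq_zero fun v _ => Finset.sum_eq_zero fun κ hκ => ?_)
  refine ρ.inner_fockRep_self_of_ne S η μ g κ fun ν h => ?_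
  obtain rfl : v = x := congrArg Sigma.fst h
  obtain rfl : κ = μ.append ν := by simpa using h
  have h1 : (μ.1 ++ ν.1).length = k := E.mem_paths.mp hκ
  rw [List.length_append] at h1
  have h2 : μ.length = μ.1.length := rfl
  omega

variable {τ : CStarTrace (GroupoidCStar V)}
  (hη : ∀ {x : V} (g : x ⟶ x), inner ℂ (η x) (ρ.W g (η x)) = τ (GroupoidCStar.u g))

include hη

theorem stateTerm_one (k : ℕ) : ρ.stateTerm S η β k 1 = partitionTerm E β τ k := by
  change (Real.exp (-β * k) : ℂ) * _ = (Real.exp (-β * k) : ℂ) * _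
  congr 1
  refine Finset.sum_congr rfl fun v _ => Finset.sum_congr rfl fun μ _ => ?_
  rw [map_one, one_apply_eq_self]
  exact ρ.inner_vec_self η hη μ

theorem norm_stateTerm_le (k : ℕ) (a : ToeplitzCStar S) :
    ‖ρ.stateTerm S η β k a‖ ≤ ‖ρ.fockRep S a‖ * ‖partitionTerm E β τ k‖ := by
  have h1 : partitionTerm E β τ k =
      ((Real.exp (-β * k) * ∑ v : V, ∑ μ ∈ E.paths v k, ‖ρ.vec η μ‖ ^ 2 : ℝ) : ℂ) := by
    rw [partitionTerm, Complex.ofReal_mul, Complex.ofReal_sum]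
    congr 1
    refine Finset.sum_congr rfl fun v _ => ?_
    rw [Complex.ofReal_sum]
    refine Finset.sum_congr rfl fun μ _ => ?_
    rw [ρ.norm_sq_vec η hη, τ.apply_u_id]
  rw [h1, Complex.norm_real, Real.norm_of_nonneg (by positivity), mul_left_comm]
  change ‖(Real.exp (-β * k) : ℂ) * _‖ ≤ _
  rw [norm_mul, Complex.norm_real, Real.norm_of_nonneg (Real.exp_pos _).le]
  refine mul_le_mul_of_nonneg_left ?_ (Real.exp_pos _).le
  rw [Finset.mul_sum]
  refine norm_sum_le_of_le _ fun v _ => ?_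
  rw [Finset.mul_sum]
  refine norm_sum_le_of_le _ fun μ _ => ?_
  refine (norm_inner_le_norm _ _).trans ?_
  have := (ρ.fockRep S a).le_opNorm (ρ.vec η μ)
  nlinarith [norm_nonneg (ρ.vec η μ)]

theorem summable_stateTerm (hs : Summable (partitionTerm E β τ)) (a : ToeplitzCStar S) :
    Summable fun k => ρ.stateTerm S η β k a :=
  Summable.of_norm_bounded (hs.norm.mul_left ‖ρ.fockRep S a‖)
    fun k => ρ.norm_stateTerm_le S η β hη k a

theorem sum_inner_repU {x : V} (g : x ⟶ x) (k : ℕ) :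
    ∑ μ ∈ E.paths x k, inner ℂ (ρ.vec η μ) (ρ.repU S (elt g) (ρ.vec η μ)) =
      ∑ μ ∈ S.fixedPaths g k, τ (GroupoidCStar.u (S.restrict g μ)) := by
  classical
  rw [SelfSimilarAction.fixedPaths, Finset.sum_filter]
  refine Finset.sum_congr rfl fun μ _ => ?_
  split_ifs with h
  · exact ρ.inner_vec_repU_vec_self S η hη g μ h
  · exact ρ.inner_vec_repU_vec_of_ne S η g μ μ h

theorem stateTerm_u {x : V} (g : x ⟶ x) (k : ℕ) :
    ρ.stateTerm S η β k (ToeplitzCStar.u S g) = psiTerm S β τ g k := by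
  change (Real.exp (-β * k) : ℂ) * _ = (Real.exp (-β * k) : ℂ) * _
  rw [← ρ.sum_inner_repU S η hη, Finset.sum_eq_single x]
  · rw [fockRep_u]
  · intro v _ hv
    refine Finset.sum_eq_zero fun μ _ => ?_
    rw [fockRep_u, repU_vec_of_ne ρ S η g μ hv.symm, inner_zero_right]
  · exact fun h => absurd (Finset.mem_univ x) h

/-- At `s_μ u_g s_μ⋆` only the vectors at the paths `μκ` contribute, so that the terms are those at
`u_g`, shifted by `|μ|`. -/
theorem stateTerm_self_add {x : V} (μ : E.Path x) (g : μ.source ⟶ μ.source) (k : ℕ) :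
    ρ.stateTerm S η β (k + μ.length) (ToeplitzCStar.s S μ * ToeplitzCStar.u S g *
      star (ToeplitzCStar.s S μ)) = (Real.exp (-β * μ.length) : ℂ) * psiTerm S β τ g k := by
  have hexp : (Real.exp (-β * (k + μ.length : ℕ)) : ℂ) =
      (Real.exp (-β * μ.length) : ℂ) * (Real.exp (-β * k) : ℂ) := by
    rw [← Complex.ofReal_mul, ← Real.exp_add]
    congr 2
    push_cast
    ring
  rw [psiTerm, ← mul_assoc, ← hexp]
  change (Real.exp (-β * (k + μ.length : ℕ)) : ℂ) * _ = _
  congr 1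
  rw [← ρ.sum_inner_repU S η hη, Finset.sum_eq_single x]
  · symm
    refine Finset.sum_of_injOn μ.append (DirGraph.Path.append_injective μ).injOn ?_ ?_ ?_
    · intro κ hκ
      have h1 : κ.1.length = k := E.mem_paths.mp hκ
      have h2 : (μ.1 ++ κ.1).length = k + μ.length := by
        rw [List.length_append, h1, add_comm]
        rfl
      exact E.mem_paths.mpr h2
    · intro κ hκ hκ'
      refine ρ.inner_fockRep_self_of_ne S η μ g κ fun ν h => hκ' ?_
      obtain rfl : κ = μ.append ν := by simpa using h
      refine ⟨ν, E.mem_paths.mpr ?_, rfl⟩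
      have h1 : (μ.1 ++ ν.1).length = k + μ.1.length := E.mem_paths.mp hκ
      rw [List.length_append] at h1
      have h2 : ν.edges.length = ν.1.length := rfl
      omega
    · exact fun κ _ => (ρ.inner_fockRep_self_append S η μ g κ).symm
  · intro v _ hv
    refine Finset.sum_eq_zero fun κ _ => ?_
    exact ρ.inner_fockRep_self_of_ne S η μ g κ fun ν h => hv (congrArg Sigma.fst h)
  · exact fun h => absurd (Finset.mem_univ x) h

/-- The state `Ψ_{β,τ}` exists: it is `Z(β, τ)⁻¹` times the sum over `k` of the functionals
`stateTerm`. -/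
theorem exists_isPsi (hs : Summable (partitionTerm E β τ)) {z : ℝ} (hz : 0 < z)
    (hZ : partitionFn E β τ = z) : ∃ Ψ : CStarState (ToeplitzCStar S), IsPsi S β τ Ψ := by
  have hZ0 : partitionFn E β τ ≠ 0 := by
    rw [hZ]
    exact Complex.ofReal_ne_zero.mpr hz.ne'
  have hsum := ρ.summable_stateTerm S η β hη hs
  let F : ToeplitzCStar S →ₗ[ℂ] ℂ :=
    { toFun := fun a => ∑' k, ρ.stateTerm S η β k a
      map_add' := fun a b => by
        simp only [map_add]
        exact (hsum a).tsum_add (hsum b)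
      map_smul' := fun c a => by
        simp only [map_smul, RingHom.id_apply]
        exact (hsum a).tsum_const_smul c }
  let Ψ : CStarState (ToeplitzCStar S) :=
    { toLinearMap := (partitionFn E β τ)⁻¹ • F
      nonneg := fun a => by
        refine mul_nonneg ?_ (tsum_nonneg fun k => ρ.stateTerm_nonneg S η β k a)
        rw [hZ, ← Complex.ofReal_inv]
        exact Complex.zero_le_real.mpr (inv_pos.mpr hz).le
      map_one := by
        change (partitionFn E β τ)⁻¹ * ∑' k, ρ.stateTerm S η β k 1 = 1
        simp only [ρ.stateTerm_one S η β hη]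
        exact inv_mul_cancel₀ hZ0 }
  refine ⟨Ψ, hs, hZ0, fun g => ?_, fun μ g => ?_, fun μ ν g hne => ?_⟩
  · exact (hsum (ToeplitzCStar.u S g)).congr fun k => ρ.stateTerm_u S η β hη g k
  · change (partitionFn E β τ)⁻¹ * ∑' k, ρ.stateTerm S η β k _ = _
    rw [← (hsum _).sum_add_tsum_nat_add μ.length,
      Finset.sum_eq_zero fun k hk => ρ.stateTerm_self_of_lt S η β μ g (Finset.mem_range.mp hk),
      zero_add]
    simp only [ρ.stateTerm_self_add S η β hη]
    rw [tsum_mul_left]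
    ring
  · change (partitionFn E β τ)⁻¹ * ∑' k, ρ.stateTerm S η β k _ = 0
    have h0 : ∀ k, ρ.stateTerm S η β k (ToeplitzCStar.s S μ * ToeplitzCStar.u S g *
        star (ToeplitzCStar.s S ν)) = 0 := fun k =>
      mul_eq_zero_of_right _ (Finset.sum_eq_zero fun v _ => Finset.sum_eq_zero fun κ _ =>
        ρ.inner_fockRep_of_ne S η μ ν g hne κ)
    simp only [h0, tsum_zero, mul_zero]

end GroupoidHilbertRep

/-! ### The restriction of `Ψ_{β,τ}` to `C⋆(𝒢)` -/

section Restriction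

theorem ToeplitzCStar.s_vertex_mul_u_mul_star {V D : Type u} [Groupoid.{u} V]
    [Fintype V] {E : DirGraph V D} (S : SelfSimilarAction E) {x y : V} (g : x ⟶ y) :
    ToeplitzCStar.s S (⟨[], trivial⟩ : E.Path y) * ToeplitzCStar.u S g *
      star (ToeplitzCStar.s S (⟨[], trivial⟩ : E.Path x)) = ToeplitzCStar.u S g := by
  have hs : ∀ z : V, ToeplitzCStar.s S (⟨[], trivial⟩ : E.Path z) = ToeplitzCStar.u S (𝟙 z) :=
    fun z => mul_one _
  have hG := (ToeplitzCStar.isToeplitzRep S).toIsGroupoidRep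
  have hstar : star (ToeplitzCStar.u S (𝟙 x)) = ToeplitzCStar.u S (𝟙 x) := by
    rw [ToeplitzCStar.u, ← hG.inv, Groupoid.inv_eq_inv, IsIso.inv_id]
  rw [hs, hs, hstar, ToeplitzCStar.u, ToeplitzCStar.u, ToeplitzCStar.u, hG.mul, hG.mul,
    Category.id_comp, Category.comp_id]

variable {V D : Type u} [Groupoid.{u} V] [Fintype V] [Finite D] {E : DirGraph V D}
  {S : SelfSimilarAction E} {β : ℝ} {τ : CStarTrace (GroupoidCStar V)}
  {Ψ : CStarState (ToeplitzCStar S)}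

theorem IsPsi.apply_u (hΨ : IsPsi S β τ Ψ) {x : V} (g : x ⟶ x) :
    Ψ (ToeplitzCStar.u S g) = (partitionFn E β τ)⁻¹ * ∑' k, psiTerm S β τ g k := by
  have h := hΨ.apply_self (⟨[], trivial⟩ : E.Path x) g
  rw [show DirGraph.Path.length (⟨[], trivial⟩ : E.Path x) = 0 from rfl, Nat.cast_zero,
    mul_zero, Real.exp_zero, Complex.ofReal_one, one_mul] at h
  exact (congrArg Ψ (ToeplitzCStar.s_vertex_mul_u_mul_star S g)).symm.trans h

theorem IsPsi.apply_u_of_ne (hΨ : IsPsi S β τ Ψ) {x y : V} (g : x ⟶ y) (hxy : x ≠ y) :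
    Ψ (ToeplitzCStar.u S g) = 0 := by
  have h := hΨ.apply_of_ne (⟨[], trivial⟩ : E.Path y) (⟨[], trivial⟩ : E.Path x) g
    fun h => hxy (congrArg Sigma.fst h).symm
  exact (congrArg Ψ (ToeplitzCStar.s_vertex_mul_u_mul_star S g)).symm.trans h

theorem continuous_toToeplitz {V D : Type u} [Groupoid.{u} V] [Fintype V] {E : DirGraph V D}
    (S : SelfSimilarAction E) : Continuous (toToeplitz S) :=
  AddMonoidHomClass.continuous_of_bound (toToeplitz S) 1 fun a => by
    simpa using NonUnitalStarAlgHom.norm_apply_le (toToeplitz S) a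

/-- For `h : x ⟶ y` and `g : y ⟶ x`, the map `μ ↦ h · μ` is a bijection from the paths fixed by `gh`
onto those fixed by `hg`, under which the restrictions are conjugate. -/
theorem psiTerm_comp_comm (S : SelfSimilarAction E) (β : ℝ) (τ : CStarTrace (GroupoidCStar V))
    {x y : V} (h : x ⟶ y) (g : y ⟶ x) (k : ℕ) :
    psiTerm S β τ (h ≫ g) k = psiTerm S β τ (g ≫ h) k := by
  classical
  rw [psiTerm, psiTerm]
  congr 1
  have hfix : ∀ {x y : V} (h : x ⟶ y) (g : y ⟶ x) (μ : E.Path x), μ ∈ S.fixedPaths (h ≫ g) k →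
      S.app g (S.app h μ) = μ ∧ S.app h μ ∈ S.fixedPaths (g ≫ h) k := by
    intro x y h g μ hμ
    obtain ⟨h1, h2⟩ := Finset.mem_filter.mp hμ
    rw [S.app_comp] at h2
    refine ⟨h2, Finset.mem_filter.mpr ⟨E.mem_paths.mpr ?_, ?_⟩⟩
    · exact (S.length_app h μ).trans (E.mem_paths.mp h1)
    · rw [S.app_comp, h2]
  refine Finset.sum_nbij' (S.app h) (S.app g) (fun μ hμ => (hfix h g μ hμ).2)
    (fun μ hμ => (hfix g h μ hμ).2) (fun μ hμ => (hfix h g μ hμ).1)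
    (fun μ hμ => (hfix g h μ hμ).1) fun μ hμ => ?_
  have hμ' := (hfix h g μ hμ).1
  have hres : elt (S.restrict h (S.app g (S.app h μ))) = elt (S.restrict h μ) := by rw [hμ']
  rw [GroupoidCStar.u_eq_of_elt_eq (S.elt_restrict_comp h g μ),
    GroupoidCStar.u_eq_of_elt_eq (S.elt_restrict_comp g h (S.app h μ)), ← GroupoidCStar.u_mul_u,
    ← GroupoidCStar.u_mul_u, τ.map_mul_comm, GroupoidCStar.u_eq_of_elt_eq hres]

/-- The restriction of `Ψ_{β,τ}` to `C⋆(𝒢)` is a trace. -/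
theorem IsPsi.map_mul_comm (hΨ : IsPsi S β τ Ψ) (a b : GroupoidCStar V) :
    Ψ (toToeplitz S (a * b)) = Ψ (toToeplitz S (b * a)) := by
  refine GroupoidCStar.map_mul_comm_of_u
    (φ := Ψ.toLinearMap ∘ₗ (toToeplitz S).toAlgHom.toLinearMap)
    (Ψ.continuous.comp (continuous_toToeplitz S)) ?_ a b
  intro x y x' y' g k
  change Ψ (toToeplitz S _) = Ψ (toToeplitz S _)
  by_cases h1 : x = y'
  · subst h1
    by_cases h2 : y = x'
    · subst h2
      rw [GroupoidCStar.u_mul_u, GroupoidCStar.u_mul_u, toToeplitz_u, toToeplitz_u, hΨ.apply_u,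
        hΨ.apply_u]
      simp only [psiTerm_comp_comm S β τ k g]
    · rw [GroupoidCStar.u_mul_u, GroupoidCStar.u_mul_u_of_ne k g (Ne.symm h2), toToeplitz_u,
        hΨ.apply_u_of_ne _ (Ne.symm h2), map_zero, map_zero]
  · rw [GroupoidCStar.u_mul_u_of_ne g k h1, map_zero, map_zero]
    by_cases h2 : x' = y
    · subst h2
      rw [GroupoidCStar.u_mul_u, toToeplitz_u, hΨ.apply_u_of_ne _ h1]
    · rw [GroupoidCStar.u_mul_u_of_ne k g h2, map_zero, map_zero]

/-- The restriction of `Ψ_{β,τ}` to `C⋆(𝒢)`, as a trace. -/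
def IsPsi.restrict (hΨ : IsPsi S β τ Ψ) : CStarTrace (GroupoidCStar V) where
  toLinearMap := Ψ.toLinearMap ∘ₗ (toToeplitz S).toAlgHom.toLinearMap
  nonneg a := by
    change 0 ≤ Ψ (toToeplitz S (star a * a))
    rw [map_mul, map_star]
    exact Ψ.nonneg _
  map_one := by
    change Ψ (toToeplitz S 1) = 1
    rw [map_one]
    exact Ψ.map_one
  map_mul_comm := hΨ.map_mul_comm

/-- `Ψ_{β,τ}` is determined on `C⋆(𝒢)` by its values on the elements `u_g`. -/
theorem IsPsi.apply_toToeplitz_eq {Ψ' : CStarState (ToeplitzCStar S)} (hΨ : IsPsi S β τ Ψ)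
    (hΨ' : IsPsi S β τ Ψ') (a : GroupoidCStar V) : Ψ (toToeplitz S a) = Ψ' (toToeplitz S a) := by
  refine LinearMap.congr_fun (GroupoidCStar.linearMap_ext
    (φ := Ψ.toLinearMap ∘ₗ (toToeplitz S).toAlgHom.toLinearMap)
    (ψ := Ψ'.toLinearMap ∘ₗ (toToeplitz S).toAlgHom.toLinearMap)
    (Ψ.continuous.comp (continuous_toToeplitz S))
    (Ψ'.continuous.comp (continuous_toToeplitz S)) ?_) a
  intro x y g
  change Ψ (toToeplitz S _) = Ψ' (toToeplitz S _)
  rw [toToeplitz_u]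
  by_cases h : x = y
  · subst h
    rw [hΨ.apply_u, hΨ'.apply_u]
  · rw [hΨ.apply_u_of_ne g h, hΨ'.apply_u_of_ne g h]

theorem existsUnique_isChi (h : ∀ τ : CStarTrace (GroupoidCStar V),
    ∃ Ψ : CStarState (ToeplitzCStar S), IsPsi S β τ Ψ) :
    ∃! χ : CStarTrace (GroupoidCStar V) → CStarTrace (GroupoidCStar V), IsChi S β χ := by
  choose Ψ hΨ using h
  refine ⟨fun τ => (hΨ τ).restrict, fun τ => ⟨Ψ τ, hΨ τ, fun a => rfl⟩,
    fun χ hχ => funext fun τ => ?_⟩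
  obtain ⟨Ψ', hΨ', hχΨ'⟩ := hχ τ
  refine CStarTrace.ext_toLinearMap (LinearMap.ext fun a => ?_)
  rw [hχΨ' a]
  exact hΨ'.apply_toToeplitz_eq (hΨ τ) a

theorem psiTerm_id (S : SelfSimilarAction E) (β : ℝ) (τ : CStarTrace (GroupoidCStar V)) (v : V)
    (k : ℕ) : psiTerm S β τ (𝟙 v) k =
      (Real.exp (-β * k) : ℂ) * ∑ μ ∈ E.paths v k, τ (GroupoidCStar.u (𝟙 μ.source)) := by
  classical
  rw [psiTerm, SelfSimilarAction.fixedPaths, Finset.filter_true_of_mem fun μ _ => S.app_id v μ]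
  congr 1
  exact Finset.sum_congr rfl fun μ _ => by
    rw [GroupoidCStar.u_eq_of_elt_eq (S.elt_restrict_id μ)]

end Restriction

/-! ### The iteration on the simplex of traces -/

/-- On the vectors `x^τ`, the map `χ_β` is the normalised application of `(I - e^{-β} A_E)⁻¹`. -/
theorem IsPsi.weight_restrict {V D : Type u} [Groupoid.{u} V] [Fintype V] [DecidableEq V]
    [Fintype D] {E : DirGraph V D} {S : SelfSimilarAction E} {β : ℝ}
    {τ τ' : CStarTrace (GroupoidCStar V)} {Ψ : CStarState (ToeplitzCStar S)} (hΨ : IsPsi S β τ Ψ)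
    (hτ' : ∀ a, τ' a = Ψ (toToeplitz S a)) {R : Matrix V V ℝ}
    (hR : ∀ v w, HasSum (fun k : ℕ => Real.exp (-β * k) * (E.adj ^ k) v w) (R v w)) :
    τ'.weight = (∑ v, (R *ᵥ τ.weight) v)⁻¹ • (R *ᵥ τ.weight) := by
  funext v
  have h1 : HasSum (psiTerm S β τ (𝟙 v)) (((R *ᵥ τ.weight) v : ℝ) : ℂ) := by
    have h2 : psiTerm S β τ (𝟙 v) = fun k : ℕ =>
        ((Real.exp (-β * k) * ((E.adj ^ k) *ᵥ τ.weight) v : ℝ) : ℂ) := funext fun k => by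
      rw [psiTerm_id, sum_paths_trace, Complex.ofReal_mul]
    rw [h2]
    exact Complex.hasSum_ofReal.mpr (hasSum_pow_mulVec E hR τ.weight v)
  rw [← Complex.ofReal_inj, ← τ'.apply_u_id, hτ', toToeplitz_u, hΨ.apply_u, h1.tsum_eq,
    partitionFn, (hasSum_partitionTerm E hR τ).tsum_eq, Pi.smul_apply, smul_eq_mul,
    Complex.ofReal_mul, Complex.ofReal_inv]

end

theorem theorem2p6 {V D : Type u} [Fintype V] [DecidableEq V] [Nonempty V] [Fintype D]
    [CategoryTheory.Groupoid.{u} V] (E : DirGraph V D) (hE : E.StronglyConnected)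
    (S : SelfSimilarAction E) (β : ℝ)
    (hβ : ENNReal.log (matrixSpectralRadius E.adj) < (β : EReal)) :
    (∃! m : V → ℝ, IsPerronFrobenius E.adj m) ∧
    (∃! χ : CStarTrace (GroupoidCStar V) → CStarTrace (GroupoidCStar V), IsChi S β χ) ∧
    IsUnit (1 - Real.exp (-β) • E.adj) ∧
    ∀ (m : V → ℝ) (χ : CStarTrace (GroupoidCStar V) → CStarTrace (GroupoidCStar V)),
      IsPerronFrobenius E.adj m → IsChi S β χ →
      ∀ τ : CStarTrace (GroupoidCStar V),
        (∃ C c : ℝ, 0 < C ∧ 0 < c ∧ c < 1 ∧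
          ∀ (n : ℕ) (v : V), ‖(χ^[n] τ) (GroupoidCStar.u (𝟙 v)) - (m v : ℂ)‖ ≤ C * c ^ n) ∧
        (∃ C c : ℝ, 0 < C ∧ 0 < c ∧ c < 1 ∧
          ∀ n : ℕ, ‖partitionFn E β (χ^[n] τ) -
            ((matrixSpectralRadius (resolventMatrix E.adj β)).toReal : ℂ)‖ ≤ C * c ^ n) := by
  obtain ⟨hPF, hunit, hR, hRpos, κ, hκ, hρ, hκm⟩ := E.resolvent_adj hE hβ
  set R : Matrix V V ℝ := resolventMatrix E.adj β
  have hweight0 : ∀ τ : CStarTrace (GroupoidCStar V), τ.weight ≠ 0 := fun τ h => by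
    simpa [h] using τ.sum_weight
  have hZ : ∀ τ : CStarTrace (GroupoidCStar V),
      partitionFn E β τ = ((∑ v, (R *ᵥ τ.weight) v : ℝ) : ℂ) :=
    fun τ => (hasSum_partitionTerm E hR τ).tsum_eq
  have hΨ : ∀ τ : CStarTrace (GroupoidCStar V),
      ∃ Ψ : CStarState (ToeplitzCStar S), IsPsi S β τ Ψ := fun τ => by
    obtain ⟨ρ, η, hη⟩ := GroupoidHilbertRep.exists_of_trace τ
    exact ρ.exists_isPsi S η β hη (hasSum_partitionTerm E hR τ).summable
      (Finset.sum_pos (fun v _ => Matrix.mulVec_pos_of_pos hRpos τ.weight_nonneg (hweight0 τ) v)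
        Finset.univ_nonempty) (hZ τ)
  refine ⟨hPF, existsUnique_isChi hΨ, hunit, fun m χ hm hχ τ => ?_⟩
  have hrec : ∀ n, (χ^[n + 1] τ).weight =
      (∑ v, (R *ᵥ (χ^[n] τ).weight) v)⁻¹ • (R *ᵥ (χ^[n] τ).weight) := fun n => by
    rw [Function.iterate_succ_apply']
    obtain ⟨Ψ, hΨ, hχΨ⟩ := hχ (χ^[n] τ)
    exact hΨ.weight_restrict hχΨ hR
  obtain ⟨C, c, hC, hc0, hc1, hconv⟩ := normalized_iterate_tendsto_exp hRpos hm.pos hm.sum_eq_one hκ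
    (hκm m hm) (x := fun n => (χ^[n] τ).weight) (fun n => (χ^[n] τ).weight_nonneg)
    (fun n => (χ^[n] τ).sum_weight) hrec
  refine ⟨⟨C, c, hC, hc0, hc1, fun n v => ?_⟩, (∑ v, ∑ w, R v w) * C, c, ?_, hc0, hc1, fun n => ?_⟩
  · rw [CStarTrace.apply_u_id, ← Complex.ofReal_sub, Complex.norm_real, Real.norm_eq_abs]
    exact hconv n v
  · exact mul_pos (Finset.sum_pos (fun v _ => Finset.sum_pos (fun w _ => hRpos v w)
      Finset.univ_nonempty) Finset.univ_nonempty) hC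
  · rw [hZ, hρ, ENNReal.toReal_ofReal hκ.le, ← Complex.ofReal_sub, Complex.norm_real]
    have h1 : κ = ∑ v, (R *ᵥ m) v := by
      rw [hκm m hm]
      simp only [Pi.smul_apply, smul_eq_mul]
      rw [← Finset.mul_sum, hm.sum_eq_one, mul_one]
    rw [h1, ← Finset.sum_sub_distrib, mul_assoc, Finset.sum_mul]
    refine norm_sum_le_of_le _ fun v _ => ?_
    rw [← Pi.sub_apply, ← Matrix.mulVec_sub, Finset.sum_mul]
    refine norm_sum_le_of_le _ fun w _ => ?_
    rw [norm_mul, Real.norm_of_nonneg (hRpos v w).le, Real.norm_eq_abs]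
    exact mul_le_mul_of_nonneg_left (hconv n w) (hRpos v w).le
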